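/- For integers $2\le m\le n$ and even $g\ge 4$, an $(m,n;g)$-bb-graph is a finite bipartite graph of girth $g$ whose set of vertex degrees is $\{m,n\}$ and in which vertices in the same bipartition class have the same degree. Let $q$ be a prime power. (a) There exists a $(q,q+1;12)$-bb-graph of order $(2q+1)(q^4-q)$. (b) Let $K$ be a field with $q$ elements, and let $H(q)$ be the split Cayley hexagon in $\mathrm{PG}(6,q)$ over $K$: its points are all points of the parabolic quadric $\mathcal P: X_0X_4+X_1X_5+X_2X_6=X_3^2$, and its lines are the lines of $\mathrm{PG}(6,q)$ that are contained in $\mathcal P$ and whose Plücker coordinates satisfy $p_{12}=p_{34}$, $p_{54}=p_{32}$, $p_{20}=p_{35}$, $p_{65}=p_{30}$, $p_{01}=p_{36}$, $p_{46}=p_{31}$. There are hyperplanes $\mathcal H$ of $\mathrm{PG}(6,q)$ for which $\mathcal P\cap\mathcal H$ is a hyperbolic quadric. For every such $\mathcal H$, delete from $H(q)$ the points lying in $\mathcal H$ and the lines contained in $\mathcal H$. Then the incidence graph of the remaining points and lines has $(2q+1)(q^4-q)$ vertices, and if $q>2$ it is a $(q,q+1;12)$-bb-graph. -/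

import Mathlib

open scoped LinearAlgebra.Projectivization

universe u

/-- An `(m, n; g)`-bb-graph: a finite bipartite graph of even girth `g`, with degree set `{m, n}`,
in which any two vertices of the same bipartition class have the same degree. -/
structure IsBBGraph {V : Type u} (G : SimpleGraph V) (m n g : ℕ) : Prop where
  finite : Finite V
  two_le : 2 ≤ m
  le : m ≤ n
  four_le : 4 ≤ g
  even_girth : Even g
  girth_eq : G.girth = g
  degree_set : Set.range (fun v : V => (G.neighborSet v).ncard) = {m, n}
  biregular : ∃ A : Set V, G.IsBipartiteWith A Aᶜ ∧
    (∀ v ∈ A, ∀ w ∈ A, (G.neighborSet v).ncard = (G.neighborSet w).ncard) ∧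
    (∀ v ∈ Aᶜ, ∀ w ∈ Aᶜ, (G.neighborSet v).ncard = (G.neighborSet w).ncard)

/-- The incidence graph (Levi graph) of a point-line geometry with incidence relation `I`. -/
def leviGraph {P L : Type u} (I : P → L → Prop) : SimpleGraph (P ⊕ L) where
  Adj x y := match x, y with
    | Sum.inl p, Sum.inr l => I p l
    | Sum.inr l, Sum.inl p => I p l
    | _, _ => False
  symm := ⟨by rintro (p | l) (p' | l') h <;> exact h⟩
  loopless := ⟨by rintro (p | l) h <;> exact h⟩

namespace SplitCayley

/-- The quadratic form `X₀X₄ + X₁X₅ + X₂X₆ - X₃²` of the parabolic quadric in `PG(6, K)`. -/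
noncomputable def form (K : Type u) [Field K] : QuadraticForm K (Fin 7 → K) :=
  QuadraticMap.proj 0 4 + QuadraticMap.proj 1 5 + QuadraticMap.proj 2 6 - QuadraticMap.proj 3 3

/-- The Plücker coordinate `p_ij` of the pair `u, v`. -/
def plucker {K : Type u} [Field K] (u v : Fin 7 → K) (i j : Fin 7) : K :=
  u i * v j - u j * v i

/-- The points of the hexagon: the points of `PG(6, K)` on the parabolic quadric. -/
def IsPoint {K : Type u} [Field K] (x : ℙ K (Fin 7 → K)) : Prop :=
  ∀ v ∈ x.submodule, form K v = 0

/-- The lines of the hexagon: the lines of `PG(6, K)` that are contained in the quadric and whose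
Plücker coordinates satisfy the six equations of Tits. (The equations are bilinear and alternating
in `u, v`, so it does not matter whether they are required for one basis or for all pairs.) -/
def IsLine {K : Type u} [Field K] (l : Submodule K (Fin 7 → K)) : Prop :=
  Module.finrank K l = 2 ∧ (∀ v ∈ l, form K v = 0) ∧
  ∀ u ∈ l, ∀ v ∈ l,
    plucker u v 1 2 = plucker u v 3 4 ∧ plucker u v 5 4 = plucker u v 3 2 ∧
    plucker u v 2 0 = plucker u v 3 5 ∧ plucker u v 6 5 = plucker u v 3 0 ∧
    plucker u v 0 1 = plucker u v 3 6 ∧ plucker u v 4 6 = plucker u v 3 1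

/-- The quadratic form `Y₀Y₁ + Y₂Y₃ + Y₄Y₅` of the hyperbolic quadric in `PG(5, K)`. -/
noncomputable def hyperbolicForm (K : Type u) [Field K] : QuadraticForm K (Fin 6 → K) :=
  QuadraticMap.proj 0 1 + QuadraticMap.proj 2 3 + QuadraticMap.proj 4 5

/-- `H` is a hyperplane of `PG(6, K)` that meets the parabolic quadric in a hyperbolic quadric. -/
def IsHyperbolicHyperplane {K : Type u} [Field K] (H : Submodule K (Fin 7 → K)) : Prop :=
  Module.finrank K H = 6 ∧ ((form K).restrict H).Equivalent (hyperbolicForm K)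

/-- The hexagon points outside `H`. -/
abbrev RemainingPoint {K : Type u} [Field K] (H : Submodule K (Fin 7 → K)) : Type u :=
  {x : ℙ K (Fin 7 → K) // IsPoint x ∧ ¬ x.submodule ≤ H}

/-- The hexagon lines that are not contained in `H`. -/
abbrev RemainingLine {K : Type u} [Field K] (H : Submodule K (Fin 7 → K)) : Type u :=
  {l : Submodule K (Fin 7 → K) // IsLine l ∧ ¬ l ≤ H}

/-- The Levi graph of the split Cayley hexagon after deleting the points in `H` and the hexagon
lines contained in `H`. -/
def complementGraph {K : Type u} [Field K] (H : Submodule K (Fin 7 → K)) :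
    SimpleGraph (RemainingPoint H ⊕ RemainingLine H) :=
  leviGraph fun x l => x.1.submodule ≤ l.1

end SplitCayley

/-! The hexagon is read inside the split octonions, written as Zorn matrices. The vectors of `K ^ 7`
are the trace-zero octonions, `form` is their norm, and Tits' six equations are six of the eight
scalar equations `uv = 0`. On a totally singular line the other two follow, so two points are
collinear exactly when their product vanishes (`IsLine.null`, `isLine_iff_of_mem`).

Short polygons are excluded algebraically. Three pairwise collinear points are dependent, so there
is no triangle (`Null.not_linearIndependent`). If `x` and `z` are both collinear with `y`, then `xz`
is a multiple of `y` (`Null.exists_mul_eq`); for non-collinear `x`, `z` this multiple is nonzero and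
determines `y`, so there is no quadrangle. In a pentagon `x₁, …, x₅`, the products `x₁x₃` and `x₄x₁`
are nonzero multiples of `x₂` and `x₅`, and the Moufang identity `(x₁x₃)(x₄x₁) = (x₁(x₃x₄))x₁` with
`x₃x₄ = 0` makes `x₂` and `x₅` collinear, which would create a triangle. Hence every cycle of the
incidence graph has length at least 12, and this passes to subgeometries.

For the counts, let `q` be the order of `K`. The quadric has `q ^ 6` singular vectors, and
subtracting those in the hyperbolic section leaves `q ^ 2 (q ^ 3 - 1)` points. A remaining line
loses exactly its one point in the hyperplane, while a remaining point keeps all its `q + 1` lines.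
Counting flags gives the number of lines.

A cycle of length at most 12 comes from pigeonhole: for `q > 2` there are more paths of length 6
from a fixed point than there are points (`NoSmallPolygons.exists_isCycle`). This inequality fails
for `q = 2`, where part (a) uses instead the subdivision of a cubic bipartite graph of girth 6 on 28
vertices. -/

/-- Zorn's vector matrices with scalar entries `s`, `t` and vector entries `a`, `b`. -/
@[ext] structure Zorn (K : Type u) where
  s : K
  a0 : K
  a1 : K
  a2 : K
  b0 : K
  b1 : K
  b2 : K
  t : K

/-! ### Multiplication of split octonions. -/

namespace Zorn

variable {K : Type u} [Field K]

instance : Zero (Zorn K) := ⟨⟨0, 0, 0, 0, 0, 0, 0, 0⟩⟩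

instance : Mul (Zorn K) := ⟨fun x y =>
  ⟨x.s * y.s + (x.a0 * y.b0 + x.a1 * y.b1 + x.a2 * y.b2),
   x.s * y.a0 + y.t * x.a0 - (x.b1 * y.b2 - x.b2 * y.b1),
   x.s * y.a1 + y.t * x.a1 - (x.b2 * y.b0 - x.b0 * y.b2),
   x.s * y.a2 + y.t * x.a2 - (x.b0 * y.b1 - x.b1 * y.b0),
   y.s * x.b0 + x.t * y.b0 + (x.a1 * y.a2 - x.a2 * y.a1),
   y.s * x.b1 + x.t * y.b1 + (x.a2 * y.a0 - x.a0 * y.a2),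
   y.s * x.b2 + x.t * y.b2 + (x.a0 * y.a1 - x.a1 * y.a0),
   x.t * y.t + (x.b0 * y.a0 + x.b1 * y.a1 + x.b2 * y.a2)⟩⟩

theorem mul_def (x y : Zorn K) : x * y =
  ⟨x.s * y.s + (x.a0 * y.b0 + x.a1 * y.b1 + x.a2 * y.b2),
   x.s * y.a0 + y.t * x.a0 - (x.b1 * y.b2 - x.b2 * y.b1),
   x.s * y.a1 + y.t * x.a1 - (x.b2 * y.b0 - x.b0 * y.b2),
   x.s * y.a2 + y.t * x.a2 - (x.b0 * y.b1 - x.b1 * y.b0),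
   y.s * x.b0 + x.t * y.b0 + (x.a1 * y.a2 - x.a2 * y.a1),
   y.s * x.b1 + x.t * y.b1 + (x.a2 * y.a0 - x.a0 * y.a2),
   y.s * x.b2 + x.t * y.b2 + (x.a0 * y.a1 - x.a1 * y.a0),
   x.t * y.t + (x.b0 * y.a0 + x.b1 * y.a1 + x.b2 * y.a2)⟩ := rfl

theorem zero_def : (0 : Zorn K) = ⟨0, 0, 0, 0, 0, 0, 0, 0⟩ := rfl

protected theorem mul_zero (x : Zorn K) : x * 0 = 0 := by simp [mul_def, zero_def]

protected theorem zero_mul (x : Zorn K) : 0 * x = 0 := by simp [mul_def, zero_def]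

/-- The Moufang identity. -/
theorem moufang (x y z : Zorn K) : (x * y) * (z * x) = (x * (y * z)) * x := by
  simp only [mul_def]
  ext <;> ring

/-- The vectors of `K ^ 7` as the Zorn matrices of trace zero. -/
def ofVec (u : Fin 7 → K) : Zorn K := ⟨-u 3, u 0, u 1, u 2, -u 4, -u 5, -u 6, u 3⟩

end Zorn

/-! ### Trace-zero octonions, vanishing products and coordinate symmetries. -/

namespace SplitCayley

variable {K : Type u} [Field K]

open Zorn

theorem form_apply (v : Fin 7 → K) :
    form K v = v 0 * v 4 + v 1 * v 5 + v 2 * v 6 - v 3 * v 3 := by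
  simp [form]

/-- Two trace-zero Zorn matrices have product zero. -/
def Null (u v : Fin 7 → K) : Prop := ofVec u * ofVec v = 0

/-- The two bracketed equations are the diagonal entries of the product; Tits' equations are the six
off-diagonal ones. -/
theorem null_iff (u v : Fin 7 → K) : Null u v ↔
    (u 3 * v 3 = u 0 * v 4 + u 1 * v 5 + u 2 * v 6 ∧
     u 3 * v 3 = u 4 * v 0 + u 5 * v 1 + u 6 * v 2) ∧
    plucker u v 1 2 = plucker u v 3 4 ∧ plucker u v 5 4 = plucker u v 3 2 ∧
    plucker u v 2 0 = plucker u v 3 5 ∧ plucker u v 6 5 = plucker u v 3 0 ∧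
    plucker u v 0 1 = plucker u v 3 6 ∧ plucker u v 4 6 = plucker u v 3 1 := by
  simp only [Null, ofVec, mul_def, zero_def, Zorn.mk.injEq, plucker]
  constructor
  · rintro ⟨h1, h2, h3, h4, h5, h6, h7, h8⟩
    refine ⟨⟨?_, ?_⟩, ?_, ?_, ?_, ?_, ?_, ?_⟩
    · linear_combination h1
    · linear_combination h8
    · linear_combination h5
    · linear_combination h4
    · linear_combination h6
    · linear_combination h2
    · linear_combination h7
    · linear_combination h3
  · rintro ⟨⟨h1, h8⟩, h5, h4, h6, h2, h7, h3⟩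
    refine ⟨?_, ?_, ?_, ?_, ?_, ?_, ?_, ?_⟩
    · linear_combination h1
    · linear_combination h2
    · linear_combination h3
    · linear_combination h4
    · linear_combination h5
    · linear_combination h6
    · linear_combination h7
    · linear_combination h8

/-- Octonion conjugation reverses products and acts as `-1` on trace zero. -/
theorem Null.symm {u v : Fin 7 → K} (h : Null u v) : Null v u := by
  rw [null_iff] at h ⊢
  simp only [plucker] at *
  obtain ⟨⟨h1, h8⟩, h5, h4, h6, h2, h7, h3⟩ := h
  refine ⟨⟨?_, ?_⟩, ?_, ?_, ?_, ?_, ?_, ?_⟩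
  · linear_combination h8
  · linear_combination h1
  · linear_combination -h5
  · linear_combination -h4
  · linear_combination -h6
  · linear_combination -h2
  · linear_combination -h7
  · linear_combination -h3

theorem null_self {u : Fin 7 → K} (h : form K u = 0) : Null u u := by
  rw [form_apply] at h
  simp only [null_iff, plucker]
  exact ⟨⟨by linear_combination -h, by linear_combination -h⟩, by ring, by ring, by ring, by ring,
    by ring, by ring⟩

/-- A linear symmetry of the quadric and of the product of trace-zero Zorn matrices. -/
structure IsSymmetry (g : (Fin 7 → K) ≃ₗ[K] (Fin 7 → K)) : Prop where
  form_map : ∀ v, form K (g v) = form K v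
  mul_map : ∀ x y z, ofVec (g x) * ofVec (g y) = ofVec (g z) ↔ ofVec x * ofVec y = ofVec z

theorem ofVec_zero : ofVec (0 : Fin 7 → K) = 0 := by simp [ofVec, zero_def]

theorem IsSymmetry.null {g : (Fin 7 → K) ≃ₗ[K] (Fin 7 → K)} (hg : IsSymmetry g)
    (x y : Fin 7 → K) : Null (g x) (g y) ↔ Null x y := by
  have := hg.mul_map x y 0
  rwa [map_zero, ofVec_zero] at this

theorem IsSymmetry.trans {g h : (Fin 7 → K) ≃ₗ[K] (Fin 7 → K)} (hg : IsSymmetry g)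
    (hh : IsSymmetry h) : IsSymmetry (g.trans h) where
  form_map v := by simp [hg.form_map, hh.form_map]
  mul_map x y z := by simp [hg.mul_map, hh.mul_map]

theorem IsSymmetry.refl : IsSymmetry (LinearEquiv.refl K (Fin 7 → K)) :=
  ⟨fun _ => rfl, fun _ _ _ => Iff.rfl⟩

/-- The cyclic permutation of the three pairs of coordinates. -/
def rotation (K : Type u) [Field K] : (Fin 7 → K) ≃ₗ[K] (Fin 7 → K) where
  toFun v := ![v 1, v 2, v 0, v 3, v 5, v 6, v 4]
  invFun v := ![v 2, v 0, v 1, v 3, v 6, v 4, v 5]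
  map_add' v w := by ext i; fin_cases i <;> rfl
  map_smul' c v := by ext i; fin_cases i <;> rfl
  left_inv v := by ext i; fin_cases i <;> rfl
  right_inv v := by ext i; fin_cases i <;> rfl

/-- The exchange of the two coordinates of each pair. -/
def exchange (K : Type u) [Field K] : (Fin 7 → K) ≃ₗ[K] (Fin 7 → K) where
  toFun v := ![v 4, v 5, v 6, -v 3, v 0, v 1, v 2]
  invFun v := ![v 4, v 5, v 6, -v 3, v 0, v 1, v 2]
  map_add' v w := by ext i; fin_cases i <;> simp [add_comm]
  map_smul' c v := by ext i; fin_cases i <;> simp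
  left_inv v := by ext i; fin_cases i <;> simp
  right_inv v := by ext i; fin_cases i <;> simp

theorem rotation_apply (v : Fin 7 → K) :
    rotation K v = ![v 1, v 2, v 0, v 3, v 5, v 6, v 4] := rfl

theorem exchange_apply (v : Fin 7 → K) :
    exchange K v = ![v 4, v 5, v 6, -v 3, v 0, v 1, v 2] := rfl

theorem isSymmetry_rotation : IsSymmetry (rotation K) where
  form_map v := by
    simp only [form_apply, rotation_apply, Matrix.cons_val]
    ring
  mul_map x y z := by
    simp only [rotation_apply, ofVec, mul_def, Zorn.mk.injEq, Matrix.cons_val]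
    constructor
    · rintro ⟨h1, h2, h3, h4, h5, h6, h7, h8⟩
      refine ⟨?_, ?_, ?_, ?_, ?_, ?_, ?_, ?_⟩
      · linear_combination h1
      · linear_combination h4
      · linear_combination h2
      · linear_combination h3
      · linear_combination h7
      · linear_combination h5
      · linear_combination h6
      · linear_combination h8
    · rintro ⟨h1, h2, h3, h4, h5, h6, h7, h8⟩
      refine ⟨?_, ?_, ?_, ?_, ?_, ?_, ?_, ?_⟩
      · linear_combination h1
      · linear_combination h3
      · linear_combination h4
      · linear_combination h2
      · linear_combination h6
      · linear_combination h7
      · linear_combination h5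
      · linear_combination h8

theorem isSymmetry_exchange : IsSymmetry (exchange K) where
  form_map v := by
    simp only [form_apply, exchange_apply, Matrix.cons_val]
    ring
  mul_map x y z := by
    simp only [exchange_apply, ofVec, mul_def, Zorn.mk.injEq, Matrix.cons_val]
    constructor <;>
    · rintro ⟨h1, h2, h3, h4, h5, h6, h7, h8⟩
      refine ⟨?_, ?_, ?_, ?_, ?_, ?_, ?_, ?_⟩
      · linear_combination h8
      · linear_combination -h5
      · linear_combination -h6
      · linear_combination -h7
      · linear_combination -h2
      · linear_combination -h3
      · linear_combination -h4
      · linear_combination h1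

/-- The symmetries move any point of the quadric to one with nonzero first coordinate. -/
theorem exists_isSymmetry {u : Fin 7 → K} (hu : u ≠ 0) (hf : form K u = 0) :
    ∃ g : (Fin 7 → K) ≃ₗ[K] (Fin 7 → K), IsSymmetry g ∧ g u 0 ≠ 0 := by
  have hr := isSymmetry_rotation (K := K)
  have he := isSymmetry_exchange (K := K)
  -- Rotations and the exchange bring each coordinate other than the one of index 3 to the front. If
  -- all six vanish, `form` leaves only the square of coordinate 3.
  by_contra! h
  have h0 := h _ .refl
  have h1 := h _ hr
  have h2 := h _ (hr.trans hr)
  have h4 := h _ he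
  have h5 := h _ (hr.trans he)
  have h6 := h _ ((hr.trans hr).trans he)
  simp only [LinearEquiv.trans_apply, rotation_apply, exchange_apply, LinearEquiv.refl_apply,
    Matrix.cons_val] at h0 h1 h2 h4 h5 h6
  rw [form_apply] at hf
  simp only [h0, h1, h2] at hf
  apply hu
  ext i
  fin_cases i <;> simp_all

end SplitCayley

/-! ### Collinearity as vanishing of the product. -/

namespace SplitCayley

variable {K : Type u} [Field K]

open Zorn

/-- Left alternativity `u(uv) = (uu)v`, together with `uu = -N(u)` for `u` of trace zero. -/
theorem ofVec_mul_ofVec_mul (u v : Fin 7 → K) :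
    ofVec u * (ofVec u * ofVec v) = ofVec (-form K u • v) := by
  simp only [form_apply, ofVec, mul_def, Pi.smul_apply, smul_eq_mul]
  ext <;> ring

theorem Null.form_eq_zero {u v : Fin 7 → K} (h : Null u v) (hu : u ≠ 0) : form K v = 0 := by
  have h1 := ofVec_mul_ofVec_mul v u
  rw [h.symm, Zorn.mul_zero] at h1
  by_contra hv
  apply hu
  simp only [zero_def, ofVec, Pi.smul_apply, smul_eq_mul, Zorn.mk.injEq, neg_mul, neg_neg,
    neg_eq_zero, mul_eq_zero, hv, false_or, @eq_comm _ (0 : K)] at h1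
  ext i
  fin_cases i <;> simp_all

theorem form_add (u v : Fin 7 → K) : form K (u + v) = form K u + form K v +
    (u 0 * v 4 + u 4 * v 0 + u 1 * v 5 + u 5 * v 1 + u 2 * v 6 + u 6 * v 2 - 2 * u 3 * v 3) := by
  simp only [form_apply, Pi.add_apply]
  ring

/-- Tits' equations kill the off-diagonal entries of `uv`, and total singularity kills its trace, so
`uv = diag(c, -c)`. Since `u(uv) = -N(u)v = 0`, a nonzero `c` would force `u = 0`. This argument
works in every characteristic. -/
theorem IsLine.null {l : Submodule K (Fin 7 → K)} (hl : IsLine l) {u v : Fin 7 → K}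
    (hu : u ∈ l) (hv : v ∈ l) : Null u v := by
  have hfu := hl.2.1 u hu
  have hfv := hl.2.1 v hv
  have hfuv := hl.2.1 _ (l.add_mem hu hv)
  obtain ⟨h5, h4, h6, h2, h7, h3⟩ := hl.2.2 u hu v hv
  rw [form_add, hfu, hfv] at hfuv
  simp only [plucker] at h5 h4 h6 h2 h7 h3
  have hc : ofVec u * ofVec v =
      ⟨u 3 * v 3 - (u 0 * v 4 + u 1 * v 5 + u 2 * v 6), 0, 0, 0, 0, 0, 0,
        -(u 3 * v 3 - (u 0 * v 4 + u 1 * v 5 + u 2 * v 6))⟩ := by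
    simp only [ofVec, mul_def, Zorn.mk.injEq]
    refine ⟨?_, ?_, ?_, ?_, ?_, ?_, ?_, ?_⟩
    · ring
    · linear_combination h2
    · linear_combination h3
    · linear_combination h4
    · linear_combination h5
    · linear_combination h6
    · linear_combination h7
    · linear_combination -hfuv
  by_cases h0 : u = 0
  · simp [null_iff, plucker, h0]
  have h1 := ofVec_mul_ofVec_mul u v
  rw [hfu, hc] at h1
  set c := u 3 * v 3 - (u 0 * v 4 + u 1 * v 5 + u 2 * v 6) with hcdef
  have hc0 : c = 0 := by
    by_contra hc0
    apply h0
    simp [ofVec, mul_def, hc0] at h1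
    ext i
    fin_cases i <;> simp_all
  rw [Null, hc, hc0, neg_zero, zero_def]

/-- The vectors whose product with `u` is zero. -/
def nullSubmodule (u : Fin 7 → K) : Submodule K (Fin 7 → K) where
  carrier := {v | Null u v}
  add_mem' {v w} hv hw := by
    simp only [Set.mem_ofPred_eq, Null, ofVec, mul_def, zero_def, Zorn.mk.injEq,
      Pi.add_apply] at hv hw ⊢
    obtain ⟨h1, h2, h3, h4, h5, h6, h7, h8⟩ := hv
    obtain ⟨k1, k2, k3, k4, k5, k6, k7, k8⟩ := hw
    refine ⟨?_, ?_, ?_, ?_, ?_, ?_, ?_, ?_⟩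
    · linear_combination h1 + k1
    · linear_combination h2 + k2
    · linear_combination h3 + k3
    · linear_combination h4 + k4
    · linear_combination h5 + k5
    · linear_combination h6 + k6
    · linear_combination h7 + k7
    · linear_combination h8 + k8
  zero_mem' := by simp [null_iff, plucker]
  smul_mem' c v hv := by
    simp only [Set.mem_ofPred_eq, Null, ofVec, mul_def, zero_def, Zorn.mk.injEq,
      Pi.smul_apply, smul_eq_mul] at hv ⊢
    obtain ⟨h1, h2, h3, h4, h5, h6, h7, h8⟩ := hv
    refine ⟨?_, ?_, ?_, ?_, ?_, ?_, ?_, ?_⟩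
    · linear_combination c * h1
    · linear_combination c * h2
    · linear_combination c * h3
    · linear_combination c * h4
    · linear_combination c * h5
    · linear_combination c * h6
    · linear_combination c * h7
    · linear_combination c * h8

@[simp] theorem mem_nullSubmodule {u v : Fin 7 → K} : v ∈ nullSubmodule u ↔ Null u v := Iff.rfl

/-- Coordinates 0, 5, 6 parametrize the null vectors of `u` once `u 0 ≠ 0`; every later computation
in `nullSubmodule u` compares only these three. -/
theorem Null.eq_zero {u v : Fin 7 → K} (h : Null u v) (hu : u 0 ≠ 0) (h0 : v 0 = 0)
    (h5 : v 5 = 0) (h6 : v 6 = 0) : v = 0 := by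
  simp only [null_iff, plucker, h0, h5, h6] at h
  obtain ⟨⟨e1, -⟩, -, -, e3, e4, e5, -⟩ := h
  have v3 : v 3 = 0 := by
    have : u 0 * v 3 = 0 := by linear_combination e4
    simpa [hu] using this
  have v2 : v 2 = 0 := by
    have : u 0 * v 2 = 0 := by rw [v3] at e3; linear_combination -e3
    simpa [hu] using this
  have v1 : v 1 = 0 := by
    have : u 0 * v 1 = 0 := by rw [v3] at e5; linear_combination e5
    simpa [hu] using this
  have v4 : v 4 = 0 := by
    have : u 0 * v 4 = 0 := by rw [v3] at e1; linear_combination -e1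
    simpa [hu] using this
  ext i
  fin_cases i <;> assumption

theorem finrank_nullSubmodule_of_ne {u : Fin 7 → K} (hu : u 0 ≠ 0) (hf : form K u = 0) :
    Module.finrank K (nullSubmodule u) = 3 := by
  rw [form_apply] at hf
  -- `f` and `g` solve the null equations with coordinates (0, 5, 6) equal to `(0, u₀², 0)` and `(0,
  -- 0, u₀²)`; the factor `u₀²` clears denominators.
  let f : Fin 7 → K := ![0, u 6 ^ 2, -u 3 * u 0 - u 5 * u 6, -u 6 * u 0, -u 3 * u 6 - u 1 * u 0,
    u 0 ^ 2, 0]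
  let g : Fin 7 → K := ![0, u 3 * u 0 - u 5 * u 6, u 5 ^ 2, u 5 * u 0, u 3 * u 5 - u 2 * u 0, 0,
    u 0 ^ 2]
  have hnu : Null u u := null_self (by rw [form_apply]; exact hf)
  have hnf : Null u f := by
    simp only [null_iff, plucker, f, Matrix.cons_val]
    refine ⟨⟨?_, ?_⟩, ?_, ?_, ?_, ?_, ?_, ?_⟩
    all_goals first
      | ring1
      | linear_combination (-u 6) * hf
      | linear_combination u 6 * hf
      | linear_combination (-u 0) * hf
  have hng : Null u g := by
    simp only [null_iff, plucker, g, Matrix.cons_val]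
    refine ⟨⟨?_, ?_⟩, ?_, ?_, ?_, ?_, ?_, ?_⟩
    all_goals first
      | ring1
      | linear_combination (-u 5) * hf
      | linear_combination u 5 * hf
      | linear_combination (-u 0) * hf
      | linear_combination u 0 * hf
  have hli : LinearIndependent K ![u, f, g] := by
    rw [Fintype.linearIndependent_iff]
    intro c hc
    simp only [Fin.sum_univ_three, Matrix.cons_val] at hc
    have c0 := congrFun hc 0
    have c5 := congrFun hc 5
    have c6 := congrFun hc 6
    simp only [Pi.add_apply, Pi.smul_apply, smul_eq_mul, f, g, Matrix.cons_val, Pi.zero_apply,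
      mul_zero, add_zero, mul_eq_zero, hu, or_false] at c0 c5 c6
    simp only [c0, zero_mul, zero_add, mul_eq_zero, pow_eq_zero_iff two_ne_zero, hu,
      or_false] at c5 c6
    intro i
    fin_cases i <;> assumption
  have hspan : nullSubmodule u = Submodule.span K (Set.range ![u, f, g]) := by
    apply le_antisymm
    · intro v hv
      let a := v 0 / u 0
      let b := (v 5 - a * u 5) / u 0 ^ 2
      let c := (v 6 - a * u 6) / u 0 ^ 2
      have hw : v - (a • u + b • f + c • g) = 0 := by
        apply Null.eq_zero (u := u) _ hu
        · simp [f, g, a, hu, Matrix.vecHead]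
        · simp [f, g, b, hu, Matrix.vecHead, Matrix.vecTail]
        · simp [f, g, c, hu, Matrix.vecHead, Matrix.vecTail]
        · exact (nullSubmodule u).sub_mem hv (add_mem (add_mem (Submodule.smul_mem _ a hnu)
            (Submodule.smul_mem _ b hnf)) (Submodule.smul_mem _ c hng))
      rw [sub_eq_zero.mp hw]
      refine add_mem (add_mem ?_ ?_) ?_ <;> refine Submodule.smul_mem _ _ (Submodule.subset_span ?_)
      exacts [⟨0, rfl⟩, ⟨1, rfl⟩, ⟨2, rfl⟩]
    · rw [Submodule.span_le]
      rintro _ ⟨i, rfl⟩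
      fin_cases i
      exacts [hnu, hnf, hng]
  rw [hspan, finrank_span_eq_card hli, Fintype.card_fin]

theorem finrank_nullSubmodule {u : Fin 7 → K} (hu : u ≠ 0) (hf : form K u = 0) :
    Module.finrank K (nullSubmodule u) = 3 := by
  obtain ⟨g, hg, h0⟩ := exists_isSymmetry hu hf
  rw [← finrank_nullSubmodule_of_ne h0 (by rw [hg.form_map, hf])]
  have : nullSubmodule (g u) = (nullSubmodule u).map g.toLinearMap := by
    ext v
    rw [Submodule.mem_map_equiv, mem_nullSubmodule, mem_nullSubmodule, ← hg.null u,
      LinearEquiv.apply_symm_apply]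
  rw [this, LinearEquiv.finrank_map_eq]

/-- Pairwise collinear points of the hexagon lie on a line. -/
theorem Null.not_linearIndependent {x y z : Fin 7 → K} (hx : x ≠ 0) (hf : form K x = 0)
    (hxy : Null x y) (hxz : Null x z) (hyz : Null y z) : ¬ LinearIndependent K ![x, y, z] := by
  intro hli
  obtain ⟨g, hg, h0⟩ := exists_isSymmetry hx hf
  rw [← hg.null] at hxy hxz hyz
  have hli' := hli.map' g.toLinearMap g.ker
  rw [Fintype.linearIndependent_iff] at hli'
  set x' := g x
  set y' := g y
  set z' := g z
  -- Subtracting multiples of `x'` gives `Y = x'₀y' - y'₀x'` and `Z = x'₀z' - z'₀x'` with zero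
  -- coordinate 0. If their (5, 6) parts are proportional, `Zᵢ Y - Yᵢ Z` vanishes by `Null.eq_zero`,
  -- and independence makes its coefficients zero.
  have key (i j : Fin 7) (hd : (x' 0 * y' 5 - y' 0 * x' 5) * (x' 0 * z' 6 - z' 0 * x' 6) =
      (x' 0 * y' 6 - y' 0 * x' 6) * (x' 0 * z' 5 - z' 0 * x' 5)) (hi : i = 5 ∨ i = 6) :
      x' 0 * z' i - z' 0 * x' i = 0 ∧ x' 0 * y' i - y' 0 * x' i = 0 := by
    have hw : (x' 0 * z' i - z' 0 * x' i) • (x' 0 • y' - y' 0 • x') -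
        (x' 0 * y' i - y' 0 * x' i) • (x' 0 • z' - z' 0 • x') = 0 := by
      apply Null.eq_zero (u := x') _ h0
      · simp; ring
      · rcases hi with rfl | rfl <;> simp
        · ring
        · linear_combination hd
      · rcases hi with rfl | rfl <;> simp
        · linear_combination -hd
        · ring
      · have hxx : Null x' x' := null_self (by rw [hg.form_map, hf])
        exact (nullSubmodule x').sub_mem
          (Submodule.smul_mem _ _ (sub_mem (Submodule.smul_mem _ _ hxy)
            (Submodule.smul_mem _ _ hxx)))
          (Submodule.smul_mem _ _ (sub_mem (Submodule.smul_mem _ _ hxz)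
            (Submodule.smul_mem _ _ hxx)))
    have h := hli' ![(x' 0 * y' i - y' 0 * x' i) * z' 0 - (x' 0 * z' i - z' 0 * x' i) * y' 0,
      (x' 0 * z' i - z' 0 * x' i) * x' 0, -((x' 0 * y' i - y' 0 * x' i) * x' 0)] (by
        rw [← hw]
        simp [Fin.sum_univ_three]
        module)
    have h1 := h 1
    have h2 := h 2
    simpa [h0] using And.intro h1 h2
  -- This is `p₆₅ = p₃₀` for the pair `Y`, `Z`, where `p₃₀` vanishes because both have zero
  -- coordinate 0.
  have hd : (x' 0 * y' 5 - y' 0 * x' 5) * (x' 0 * z' 6 - z' 0 * x' 6) =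
      (x' 0 * y' 6 - y' 0 * x' 6) * (x' 0 * z' 5 - z' 0 * x' 5) := by
    simp only [null_iff, plucker] at hxy hxz hyz
    linear_combination -x' 0 ^ 2 * hyz.2.2.2.2.1 + x' 0 * y' 0 * hxz.2.2.2.2.1
      - x' 0 * z' 0 * hxy.2.2.2.2.1
  obtain ⟨-, hy5⟩ := key 5 0 hd (.inl rfl)
  obtain ⟨-, hy6⟩ := key 6 0 hd (.inr rfl)
  have hw : x' 0 • y' - y' 0 • x' = 0 := by
    apply Null.eq_zero (u := x') _ h0
    · simp; ring
    · simpa using hy5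
    · simpa using hy6
    · have hxx : Null x' x' := null_self (by rw [hg.form_map, hf])
      exact sub_mem (Submodule.smul_mem (nullSubmodule x') _ hxy) (Submodule.smul_mem _ _ hxx)
  have h := hli' ![-y' 0, x' 0, 0] (by
    rw [← hw]
    simp [Fin.sum_univ_three]
    module) 1
  exact h0 (by simpa using h)

/-- The product of two points collinear with `y` is a multiple of `y`. -/
theorem Null.exists_mul_eq {x y z : Fin 7 → K} (hy : y ≠ 0) (hf : form K y = 0)
    (hxy : Null x y) (hzy : Null z y) : ∃ c : K, ofVec x * ofVec z = ofVec (c • y) := by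
  obtain ⟨g, hg, h0⟩ := exists_isSymmetry hy hf
  rw [← hg.null] at hxy hzy
  set x' := g x with hx'
  set y' := g y with hy'
  set z' := g z with hz'
  suffices h : ∃ c : K, ofVec x' * ofVec z' = ofVec (c • y') by
    obtain ⟨c, hc⟩ := h
    rw [hy', ← map_smul, hg.mul_map] at hc
    exact ⟨c, hc⟩
  simp only [null_iff, plucker] at hxy hzy
  obtain ⟨⟨h1, h8⟩, h5, h4, h6, h2, h7, h3⟩ := hxy
  obtain ⟨⟨k1, k8⟩, k5, k4, k6, k2, k7, k3⟩ := hzy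
  clear_value x' y' z'
  -- The scalar is forced by comparing the entries `a0`; the remaining entries agree after
  -- multiplication by `y' 0`.
  let c := (-x' 3 * z' 0 + z' 3 * x' 0 - (x' 5 * z' 6 - x' 6 * z' 5)) / y' 0
  have hc : c * y' 0 = -x' 3 * z' 0 + z' 3 * x' 0 - (x' 5 * z' 6 - x' 6 * z' 5) :=
    div_mul_cancel₀ _ h0
  refine ⟨c, ?_⟩
  clear_value c
  simp only [ofVec, mul_def, Zorn.mk.injEq, Pi.smul_apply, smul_eq_mul]
  refine ⟨?_, ?_, ?_, ?_, ?_, ?_, ?_, ?_⟩ <;> apply mul_left_cancel₀ h0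
  · linear_combination y' 3 * hc + x' 0 * k8 + z' 5 * h7 - z' 6 * h6 - x' 3 * k2
  · linear_combination -y' 0 * hc
  · linear_combination -y' 1 * hc + x' 6 * k8 + x' 3 * k7 - z' 6 * h8 - z' 3 * h7
  · linear_combination -y' 2 * hc - x' 5 * k8 - x' 3 * k6 + z' 5 * h8 + z' 3 * h6
  · linear_combination y' 4 * hc + x' 3 * k8 - z' 6 * h4 - z' 5 * h3 + x' 1 * k6
      + z' 0 * h5 + x' 2 * k7 - x' 4 * k2 - z' 3 * h1
  · linear_combination y' 5 * hc - x' 0 * k6 + z' 0 * h6 + z' 5 * h2 - x' 5 * k2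
  · linear_combination y' 6 * hc - x' 0 * k7 + z' 0 * h7 + z' 6 * h2 - x' 6 * k2
  · linear_combination -y' 3 * hc + z' 0 * h8 - z' 3 * h2 + x' 5 * k7 - x' 6 * k6

end SplitCayley

/-! ### Geometries without small polygons. -/

/-- A partial linear space without triangles, quadrangles and pentagons. -/
structure NoSmallPolygons {P L : Type u} (I : P → L → Prop) : Prop where
  line_unique : ∀ {p₁ p₂ l₁ l₂}, p₁ ≠ p₂ → I p₁ l₁ → I p₂ l₁ → I p₁ l₂ → I p₂ l₂ → l₁ = l₂
  triangle : ∀ {p₁ p₂ p₃ l₁ l₂ l₃}, p₁ ≠ p₂ → p₂ ≠ p₃ → p₃ ≠ p₁ → l₁ ≠ l₂ → l₂ ≠ l₃ → l₃ ≠ l₁ →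
    I p₁ l₁ → I p₂ l₁ → I p₂ l₂ → I p₃ l₂ → I p₃ l₃ → ¬ I p₁ l₃
  quadrangle : ∀ {p₁ p₂ p₃ p₄ l₁ l₂ l₃ l₄}, p₁ ≠ p₂ → p₂ ≠ p₃ → p₃ ≠ p₄ → p₄ ≠ p₁ → p₂ ≠ p₄ →
    l₁ ≠ l₂ → l₂ ≠ l₃ → l₃ ≠ l₄ → l₄ ≠ l₁ →
    I p₁ l₁ → I p₂ l₁ → I p₂ l₂ → I p₃ l₂ → I p₃ l₃ → I p₄ l₃ → I p₄ l₄ → ¬ I p₁ l₄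
  pentagon : ∀ {p₁ p₂ p₃ p₄ p₅ l₁ l₂ l₃ l₄ l₅},
    p₁ ≠ p₂ → p₂ ≠ p₃ → p₃ ≠ p₄ → p₄ ≠ p₅ → p₅ ≠ p₁ →
    l₁ ≠ l₂ → l₂ ≠ l₃ → l₃ ≠ l₄ → l₄ ≠ l₅ → l₅ ≠ l₁ →
    I p₁ l₁ → I p₂ l₁ → I p₂ l₂ → I p₃ l₂ → I p₃ l₃ → I p₄ l₃ → I p₄ l₄ → I p₅ l₄ → I p₅ l₅ →
    ¬ I p₁ l₅

theorem NoSmallPolygons.comap {P L P' L' : Type u} {I : P → L → Prop} (h : NoSmallPolygons I)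
    {f : P' → P} {g : L' → L} (hf : f.Injective) (hg : g.Injective) :
    NoSmallPolygons fun p l => I (f p) (g l) where
  line_unique h₁ a b c d := hg (h.line_unique (hf.ne h₁) a b c d)
  triangle a b c a' b' c' :=
    h.triangle (hf.ne a) (hf.ne b) (hf.ne c) (hg.ne a') (hg.ne b') (hg.ne c')
  quadrangle a b c d e a' b' c' d' :=
    h.quadrangle (hf.ne a) (hf.ne b) (hf.ne c) (hf.ne d) (hf.ne e) (hg.ne a') (hg.ne b')
      (hg.ne c') (hg.ne d')
  pentagon a b c d e a' b' c' d' e' :=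
    h.pentagon (hf.ne a) (hf.ne b) (hf.ne c) (hf.ne d) (hf.ne e) (hg.ne a') (hg.ne b')
      (hg.ne c') (hg.ne d') (hg.ne e')

theorem card_sigma_of_const {A : Type*} [Finite A] {B : A → Type*} [∀ a, Finite (B a)] {b : ℕ}
    (h : ∀ a, Nat.card (B a) = b) : Nat.card (Σ a, B a) = Nat.card A * b := by
  have := Fintype.ofFinite A
  rw [Nat.card_sigma, Finset.sum_congr rfl fun a _ => h a, Finset.sum_const, Finset.card_univ,
    Nat.card_eq_fintype_card, smul_eq_mul]

/-! ### Girth and degrees of Levi graphs. -/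

section Levi

variable {P L : Type u} {I : P → L → Prop}

@[simp] theorem leviGraph_adj_inl_inr {p : P} {l : L} :
    (leviGraph I).Adj (Sum.inl p) (Sum.inr l) ↔ I p l := Iff.rfl

@[simp] theorem leviGraph_adj_inr_inl {p : P} {l : L} :
    (leviGraph I).Adj (Sum.inr l) (Sum.inl p) ↔ I p l := Iff.rfl

@[simp] theorem leviGraph_not_adj_inl_inl {p p' : P} :
    ¬ (leviGraph I).Adj (Sum.inl p) (Sum.inl p') := fun h => h

@[simp] theorem leviGraph_not_adj_inr_inr {l l' : L} :
    ¬ (leviGraph I).Adj (Sum.inr l) (Sum.inr l') := fun h => h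

theorem leviGraph_getVert {p : P} {v : P ⊕ L} (w : (leviGraph I).Walk (Sum.inl p) v) (j : ℕ) :
    (2 * j ≤ w.length → ∃ p', w.getVert (2 * j) = Sum.inl p') ∧
    (2 * j + 1 ≤ w.length → ∃ l, w.getVert (2 * j + 1) = Sum.inr l) := by
  have step : ∀ j, (2 * j ≤ w.length → ∃ p', w.getVert (2 * j) = Sum.inl p') →
      2 * j + 1 ≤ w.length → ∃ l, w.getVert (2 * j + 1) = Sum.inr l := by
    intro j h hj
    obtain ⟨p', hp'⟩ := h (by lia)
    have hadj := w.adj_getVert_succ (i := 2 * j) (by lia)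
    rw [hp'] at hadj
    rcases hl : w.getVert (2 * j + 1) with q | l
    · rw [hl] at hadj
      exact absurd hadj leviGraph_not_adj_inl_inl
    · exact ⟨l, rfl⟩
  induction j with
  | zero =>
    have h0 : 2 * 0 ≤ w.length → ∃ p', w.getVert (2 * 0) = Sum.inl p' := fun _ => ⟨p, by simp⟩
    exact ⟨h0, step 0 h0⟩
  | succ j ih =>
    have h0 : 2 * (j + 1) ≤ w.length → ∃ p', w.getVert (2 * (j + 1)) = Sum.inl p' := by
      intro hj
      obtain ⟨l, hl⟩ := ih.2 (by lia)
      have hadj := w.adj_getVert_succ (i := 2 * j + 1) (by lia)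
      rw [hl] at hadj
      rcases hq : w.getVert (2 * j + 1 + 1) with q | l'
      · exact ⟨q, rfl⟩
      · rw [hq] at hadj
        exact absurd hadj leviGraph_not_adj_inr_inr
    exact ⟨h0, step _ h0⟩

theorem NoSmallPolygons.twelve_le_of_inl (h : NoSmallPolygons I) {p : P}
    {w : (leviGraph I).Walk (Sum.inl p) (Sum.inl p)} (hw : w.IsCycle) : 12 ≤ w.length := by
  by_contra! hlt
  have h3 := hw.three_le_length
  choose hp hl using leviGraph_getVert w
  obtain ⟨l₀, -⟩ := hl 0 (by lia)
  have : Nonempty P := ⟨p⟩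
  have : Nonempty L := ⟨l₀⟩
  choose! p hp using hp
  choose! l hl using hl
  -- After an odd number of steps from a point the walk is at a line, so it cannot have closed up.
  have heven : ∃ k, w.length = 2 * k := by
    rcases Nat.even_or_odd' w.length with ⟨k, hk | hk⟩
    · exact ⟨k, hk⟩
    · have := hl k hk.ge
      rw [← hk, w.getVert_length] at this
      exact absurd this (by simp)
  obtain ⟨k, hk⟩ := heven
  have hpk : p k = p 0 := by
    have h1 := hp k hk.ge
    have h2 := hp 0 (by lia)
    rw [← hk, w.getVert_length] at h1
    rw [mul_zero, w.getVert_zero] at h2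
    exact Sum.inl_injective (h1.symm.trans h2)
  have hpl : ∀ j, j < k → I (p j) (l j) := by
    intro j hj
    have := w.adj_getVert_succ (i := 2 * j) (by lia)
    rwa [hp j (by lia), hl j (by lia)] at this
  have hlp : ∀ j, j < k → I (p (j + 1)) (l j) := by
    intro j hj
    have := w.adj_getVert_succ (i := 2 * j + 1) (by lia)
    rwa [hl j (by lia), show 2 * j + 1 + 1 = 2 * (j + 1) by ring, hp (j + 1) (by lia)] at this
  have hpne : ∀ i j, i < j → j < k → p i ≠ p j := by
    intro i j hij hj heq
    have := hw.getVert_injOn' (x₁ := 2 * i) (x₂ := 2 * j) (by rw [Set.mem_ofPred]; lia)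
      (by rw [Set.mem_ofPred]; lia) (by rw [hp i (by lia), hp j (by lia), heq])
    lia
  have hlne : ∀ i j, i < j → j < k → l i ≠ l j := by
    intro i j hij hj heq
    have := hw.getVert_injOn' (x₁ := 2 * i + 1) (x₂ := 2 * j + 1) (by rw [Set.mem_ofPred]; lia)
      (by rw [Set.mem_ofPred]; lia) (by rw [hl i (by lia), hl j (by lia), heq])
    lia
  have hk2 : 2 ≤ k := by lia
  have hk6 : k < 6 := by lia
  clear hp hl hk hw hlt h3
  have hlast := hlp (k - 1) (by lia)
  rw [Nat.sub_add_cancel (by lia), hpk] at hlast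
  interval_cases k
  · exact hlne 0 1 (by lia) (by lia) (h.line_unique (hpne 0 1 (by lia) (by lia))
      (hpl 0 (by lia)) (hlp 0 (by lia)) hlast (hpl 1 (by lia)))
  · exact h.triangle (hpne 0 1 (by lia) (by lia)) (hpne 1 2 (by lia) (by lia))
      (hpne 0 2 (by lia) (by lia)).symm (hlne 0 1 (by lia) (by lia)) (hlne 1 2 (by lia) (by lia))
      (hlne 0 2 (by lia) (by lia)).symm (hpl 0 (by lia)) (hlp 0 (by lia)) (hpl 1 (by lia))
      (hlp 1 (by lia)) (hpl 2 (by lia)) hlast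
  · exact h.quadrangle (hpne 0 1 (by lia) (by lia)) (hpne 1 2 (by lia) (by lia))
      (hpne 2 3 (by lia) (by lia)) (hpne 0 3 (by lia) (by lia)).symm (hpne 1 3 (by lia) (by lia))
      (hlne 0 1 (by lia) (by lia)) (hlne 1 2 (by lia) (by lia)) (hlne 2 3 (by lia) (by lia))
      (hlne 0 3 (by lia) (by lia)).symm (hpl 0 (by lia)) (hlp 0 (by lia)) (hpl 1 (by lia))
      (hlp 1 (by lia)) (hpl 2 (by lia)) (hlp 2 (by lia)) (hpl 3 (by lia)) hlast
  · exact h.pentagon (hpne 0 1 (by lia) (by lia)) (hpne 1 2 (by lia) (by lia))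
      (hpne 2 3 (by lia) (by lia)) (hpne 3 4 (by lia) (by lia)) (hpne 0 4 (by lia) (by lia)).symm
      (hlne 0 1 (by lia) (by lia)) (hlne 1 2 (by lia) (by lia)) (hlne 2 3 (by lia) (by lia))
      (hlne 3 4 (by lia) (by lia)) (hlne 0 4 (by lia) (by lia)).symm
      (hpl 0 (by lia)) (hlp 0 (by lia)) (hpl 1 (by lia)) (hlp 1 (by lia)) (hpl 2 (by lia))
      (hlp 2 (by lia)) (hpl 3 (by lia)) (hlp 3 (by lia)) (hpl 4 (by lia)) hlast

theorem NoSmallPolygons.twelve_le (h : NoSmallPolygons I) {v : P ⊕ L}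
    {w : (leviGraph I).Walk v v} (hw : w.IsCycle) : 12 ≤ w.length := by
  classical
  rcases v with p | l
  · exact h.twelve_le_of_inl hw
  · have h3 := hw.three_le_length
    have hadj := w.adj_getVert_succ (i := 0) (by lia)
    rw [w.getVert_zero] at hadj
    have hmem : w.getVert (0 + 1) ∈ w.support := w.getVert_mem_support _
    rcases hq : w.getVert (0 + 1) with q | l'
    · rw [hq] at hmem
      have := h.twelve_le_of_inl (hw.rotate hmem)
      rwa [SimpleGraph.Walk.length_rotate] at this
    · rw [hq] at hadj
      exact absurd hadj leviGraph_not_adj_inr_inr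

theorem NoSmallPolygons.girth_eq (h : NoSmallPolygons I) {v : P ⊕ L}
    {w : (leviGraph I).Walk v v} (hw : w.IsCycle) (hle : w.length ≤ 12) :
    (leviGraph I).girth = 12 := by
  have hac : ¬ (leviGraph I).IsAcyclic := fun hac => hac w hw
  apply le_antisymm ((SimpleGraph.girth_le_length hw).trans hle)
  obtain ⟨a, w', hw', he⟩ := SimpleGraph.exists_girth_eq_length.mpr hac
  rw [he]
  exact h.twelve_le hw'

/-- The flags that follow a given flag on a path. -/
def nextFlags (I : P → L → Prop) (x : L × P) : Set (L × P) :=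
  {y | (I x.2 y.1 ∧ y.1 ≠ x.1) ∧ I y.2 y.1 ∧ y.2 ≠ x.2}

theorem ncard_sigma_eq [Finite P] [Finite L] {A : Set L} {B : L → Set P} {a b : ℕ}
    (hA : A.ncard = a) (hB : ∀ l ∈ A, (B l).ncard = b) :
    {y : L × P | y.1 ∈ A ∧ y.2 ∈ B y.1}.ncard = a * b := by
  let e : {y : L × P | y.1 ∈ A ∧ y.2 ∈ B y.1} ≃ Σ l : A, B l :=
    { toFun := fun y => ⟨⟨y.1.1, y.2.1⟩, ⟨y.1.2, y.2.2⟩⟩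
      invFun := fun z => ⟨(z.1.1, z.2.1), z.1.2, z.2.2⟩
      left_inv := fun _ => rfl
      right_inv := fun _ => rfl }
  rw [← Nat.card_coe_set_eq, Nat.card_congr e, card_sigma_of_const (b := b), Nat.card_coe_set_eq,
    hA]
  intro l
  rw [Nat.card_coe_set_eq, hB l l.2]

theorem ncard_nextFlags [Finite P] [Finite L] {a b : ℕ} (ha : ∀ p, {l | I p l}.ncard = a)
    (hb : ∀ l, {p | I p l}.ncard = b) {x : L × P} (hx : I x.2 x.1) :
    (nextFlags I x).ncard = (a - 1) * (b - 1) := by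
  refine ncard_sigma_eq (A := {l | I x.2 l ∧ l ≠ x.1}) (B := fun l => {p | I p l ∧ p ≠ x.2}) ?_ ?_
  · rw [← ha x.2, ← Set.ncard_sdiff_singleton_of_mem (show x.1 ∈ {l | I x.2 l} from hx)]
    rfl
  · intro l hl
    rw [← hb l, ← Set.ncard_sdiff_singleton_of_mem (show x.2 ∈ {p | I p l} from hl.1)]
    rfl

/-- The Moore bound argument: with too few points there is a cycle of length at most twelve. -/
theorem NoSmallPolygons.exists_isCycle [Finite P] [Finite L] (h : NoSmallPolygons I) {a b : ℕ}
    (ha : ∀ p, {l | I p l}.ncard = a) (hb : ∀ l, {p | I p l}.ncard = b) (p₀ : P)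
    (hlt : Nat.card P < a * (b - 1) * ((a - 1) * (b - 1)) * ((a - 1) * (b - 1))) :
    ∃ (v : P ⊕ L) (w : (leviGraph I).Walk v v), w.IsCycle ∧ w.length ≤ 12 := by
  let A₁ : Set (L × P) := {y | y.1 ∈ {l | I p₀ l} ∧ y.2 ∈ {p | I p y.1 ∧ p ≠ p₀}}
  have h₁ : Nat.card A₁ = a * (b - 1) := by
    rw [Nat.card_coe_set_eq]
    refine ncard_sigma_eq (B := fun l => {p | I p l ∧ p ≠ p₀}) (ha p₀) fun l hl => ?_
    rw [← hb l, ← Set.ncard_sdiff_singleton_of_mem (show p₀ ∈ {p | I p l} from hl)]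
    rfl
  have h₂ : Nat.card (Σ x : A₁, nextFlags I x) = a * (b - 1) * ((a - 1) * (b - 1)) := by
    rw [card_sigma_of_const (b := (a - 1) * (b - 1)), h₁]
    intro x
    rw [Nat.card_coe_set_eq, ncard_nextFlags ha hb x.2.2.1]
  have h₃ : Nat.card (Σ y : (Σ x : A₁, nextFlags I x), nextFlags I y.2) =
      a * (b - 1) * ((a - 1) * (b - 1)) * ((a - 1) * (b - 1)) := by
    rw [card_sigma_of_const (b := (a - 1) * (b - 1)), h₂]
    intro y
    rw [Nat.card_coe_set_eq, ncard_nextFlags ha hb y.2.2.2.1]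
  -- Pigeonhole on the end points of the three-step flag sequences starting at `p₀`.
  rw [← h₃] at hlt
  have hinj : ¬ Function.Injective
      fun z : (Σ y : (Σ x : A₁, nextFlags I x), nextFlags I y.2) => z.2.1.2 :=
    fun hinj => hlt.not_ge (Nat.card_le_card_of_injective _ hinj)
  have hpath : ∀ z : (Σ y : (Σ x : A₁, nextFlags I x), nextFlags I y.2),
      ∃ w : (leviGraph I).Walk (Sum.inl p₀) (Sum.inl z.2.1.2), w.IsPath ∧ w.length = 6 ∧
        w.support = [Sum.inl p₀, Sum.inr z.1.1.1.1, Sum.inl z.1.1.1.2, Sum.inr z.1.2.1.1,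
          Sum.inl z.1.2.1.2, Sum.inr z.2.1.1, Sum.inl z.2.1.2] := by
    rintro ⟨⟨⟨⟨l₁, p₁⟩, i₁, i₂, n₁⟩, ⟨l₂, p₂⟩, ⟨i₃, n₂⟩, i₄, n₃⟩, ⟨l₃, p₃⟩, ⟨i₅, n₄⟩, i₆, n₅⟩
    change p₁ ≠ p₀ at n₁
    change l₂ ≠ l₁ at n₂
    change p₂ ≠ p₁ at n₃
    change l₃ ≠ l₂ at n₄
    change p₃ ≠ p₂ at n₅
    dsimp only at i₁ i₂ i₃ i₄ i₅ i₆
    refine ⟨.cons (leviGraph_adj_inl_inr.mpr i₁) <| .cons (leviGraph_adj_inr_inl.mpr i₂) <|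
      .cons (leviGraph_adj_inl_inr.mpr i₃) <| .cons (leviGraph_adj_inr_inl.mpr i₄) <|
      .cons (leviGraph_adj_inl_inr.mpr i₅) <| .cons (leviGraph_adj_inr_inl.mpr i₆) .nil, ?_,
      rfl, rfl⟩
    -- A repeated vertex would put two points on two lines, or, when the last point is `p₀`, produce
    -- a triangle.
    have m₁ : p₂ ≠ p₀ := by
      rintro rfl
      exact n₂ (h.line_unique n₃ i₄ i₃ i₁ i₂)
    have m₂ : p₃ ≠ p₁ := by
      rintro rfl
      exact n₄ (h.line_unique n₅ i₆ i₅ i₃ i₄)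
    have m₃ : l₃ ≠ l₁ := by
      rintro rfl
      exact n₂ (h.line_unique n₃ i₄ i₃ i₅ i₂)
    have m₄ : p₃ ≠ p₀ := by
      rintro rfl
      exact h.triangle n₁.symm n₃.symm n₅.symm n₂.symm n₄.symm m₃ i₁ i₂ i₃ i₄ i₅ i₆
    simp [SimpleGraph.Walk.isPath_def, n₁.symm, n₂.symm, n₃.symm, n₄.symm, n₅.symm, m₁.symm,
      m₂.symm, m₃.symm, m₄.symm]
  simp only [Function.Injective, not_forall] at hinj
  obtain ⟨z, z', heq, hne⟩ := hinj
  obtain ⟨w, hw, hw6, hws⟩ := hpath z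
  obtain ⟨w', hw', hw6', hws'⟩ := hpath z'
  have hww : w ≠ w'.copy rfl (by rw [heq]) := by
    intro hww
    have := congrArg SimpleGraph.Walk.support hww
    rw [SimpleGraph.Walk.support_copy, hws, hws'] at this
    simp only [List.cons.injEq, Sum.inl.injEq, Sum.inr.injEq] at this
    obtain ⟨-, e₁, e₂, e₃, e₄, e₅, e₆, -⟩ := this
    apply hne
    obtain ⟨⟨⟨⟨l₁, p₁⟩, _⟩, ⟨l₂, p₂⟩, _⟩, ⟨l₃, p₃⟩, _⟩ := z
    obtain ⟨⟨⟨⟨l₁', p₁'⟩, _⟩, ⟨l₂', p₂'⟩, _⟩, ⟨l₃', p₃'⟩, _⟩ := z'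
    dsimp at e₁ e₂ e₃ e₄ e₅ e₆
    subst e₁ e₂ e₃ e₄ e₅ e₆
    rfl
  -- The cycle is glued from a subwalk of each path, and each path has length 6.
  obtain ⟨u', v', p', q', hp', hq', hc⟩ := hw.exists_isCycle_of_ne (q := w'.copy rfl (by rw [heq]))
    (by simpa using hw') hww
  refine ⟨_, _, hc, ?_⟩
  have := (SimpleGraph.Walk.isSubwalk_iff_support_isInfix.mp hp').length_le
  have := (SimpleGraph.Walk.isSubwalk_iff_support_isInfix.mp hq').length_le
  simp only [SimpleGraph.Walk.length_append, SimpleGraph.Walk.length_reverse,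
    SimpleGraph.Walk.length_copy, SimpleGraph.Walk.length_support] at *
  lia

theorem leviGraph_neighborSet_inl (p : P) :
    ((leviGraph I).neighborSet (Sum.inl p)).ncard = {l | I p l}.ncard := by
  rw [← Set.ncard_image_of_injective {l | I p l} (Sum.inr_injective (α := P))]
  congr 1
  ext (q | l) <;> simp

theorem leviGraph_neighborSet_inr (l : L) :
    ((leviGraph I).neighborSet (Sum.inr l)).ncard = {p | I p l}.ncard := by
  rw [← Set.ncard_image_of_injective {p | I p l} (Sum.inl_injective (β := L))]
  congr 1
  ext (q | l) <;> simp

theorem NoSmallPolygons.isBBGraph [Finite P] [Finite L] [Nonempty P] [Nonempty L]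
    (h : NoSmallPolygons I) {m n : ℕ} (hm : 2 ≤ m) (hmn : m ≤ n)
    (hP : ∀ p, {l | I p l}.ncard = n) (hL : ∀ l, {p | I p l}.ncard = m) {v : P ⊕ L}
    {w : (leviGraph I).Walk v v} (hw : w.IsCycle) (hle : w.length ≤ 12) :
    IsBBGraph (leviGraph I) m n 12 where
  finite := inferInstance
  two_le := hm
  le := hmn
  four_le := by norm_num
  even_girth := by decide
  girth_eq := h.girth_eq hw hle
  degree_set := by
    ext d
    simp only [Set.mem_range, Sum.exists, leviGraph_neighborSet_inl, leviGraph_neighborSet_inr,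
      hP, hL, exists_const, Set.mem_insert_iff, Set.mem_singleton_iff]
    rw [or_comm, eq_comm, @eq_comm _ n]
  biregular := by
    refine ⟨Set.range Sum.inl, ⟨disjoint_compl_right, ?_⟩, ?_, ?_⟩
    · rintro (p | l) (p' | l') hadj
      · exact absurd hadj leviGraph_not_adj_inl_inl
      · simp
      · simp
      · exact absurd hadj leviGraph_not_adj_inr_inr
    · rintro _ ⟨p, rfl⟩ _ ⟨p', rfl⟩
      simp only [leviGraph_neighborSet_inl, hP]
    · rintro (p | l) hp (p' | l') hp'
      · exact absurd ⟨p, rfl⟩ hp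
      · exact absurd ⟨p, rfl⟩ hp
      · exact absurd ⟨p', rfl⟩ hp'
      · simp only [leviGraph_neighborSet_inr, hL]

end Levi

theorem IsBBGraph.of_iso {V : Type u} {W : Type*} {G : SimpleGraph V} {G' : SimpleGraph W}
    (e : G ≃g G') {m n g : ℕ} (h : IsBBGraph G m n g) : IsBBGraph G' m n g := by
  have hdeg : ∀ v, (G'.neighborSet (e v)).ncard = (G.neighborSet v).ncard := by
    intro v
    rw [← Set.ncard_image_of_injective _ e.injective]
    congr 1
    ext w
    obtain ⟨w, rfl⟩ := e.surjective w
    simp [e.map_adj_iff]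
  obtain ⟨A, hA, h₁, h₂⟩ := h.biregular
  exact
  { finite := have := h.finite; Finite.of_equiv V e.toEquiv
    two_le := h.two_le
    le := h.le
    four_le := h.four_le
    even_girth := h.even_girth
    girth_eq := by rw [← e.girth_eq, h.girth_eq]
    degree_set := by
      rw [← h.degree_set]
      ext d
      simp only [Set.mem_range, ← hdeg]
      exact e.surjective.exists
    biregular := by
      refine ⟨e.symm ⁻¹' A, ⟨disjoint_compl_right, ?_⟩, ?_, ?_⟩
      · intro v w hvw
        exact hA.mem_of_adj (e.symm.map_rel_iff.mpr hvw)
      · intro v hv w hw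
        simpa [← hdeg] using h₁ _ hv _ hw
      · intro v hv w hw
        simpa [← hdeg] using h₂ _ hv _ hw }

/-! ### The hexagon has no small polygons. -/

namespace SplitCayley

variable {K : Type u} [Field K]

open Zorn

theorem submodule_le_iff {x : ℙ K (Fin 7 → K)} {l : Submodule K (Fin 7 → K)} :
    x.submodule ≤ l ↔ x.rep ∈ l := by
  rw [Projectivization.submodule_eq, Submodule.span_singleton_le_iff_mem]

theorem IsPoint.form_rep {x : ℙ K (Fin 7 → K)} (hx : IsPoint x) : form K x.rep = 0 :=
  hx _ (submodule_le_iff.mp le_rfl)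

theorem span_pair_eq {l : Submodule K (Fin 7 → K)} (hl : Module.finrank K l = 2)
    {x y : ℙ K (Fin 7 → K)} (hxy : x ≠ y) (hx : x.submodule ≤ l) (hy : y.submodule ≤ l) :
    Submodule.span K (Set.range ![x.rep, y.rep]) = l := by
  apply Submodule.eq_of_le_of_finrank_eq
  · rw [Submodule.span_le]
    rintro _ ⟨i, rfl⟩
    fin_cases i
    exacts [submodule_le_iff.mp hx, submodule_le_iff.mp hy]
  · rw [finrank_span_eq_card (Projectivization.linearIndependent_pair_iff_ne.mpr hxy), hl,
      Fintype.card_fin]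

theorem line_unique {l l' : Submodule K (Fin 7 → K)} (hl : Module.finrank K l = 2)
    (hl' : Module.finrank K l' = 2) {x y : ℙ K (Fin 7 → K)} (hxy : x ≠ y) (hx : x.submodule ≤ l)
    (hy : y.submodule ≤ l) (hx' : x.submodule ≤ l') (hy' : y.submodule ≤ l') : l = l' := by
  rw [← span_pair_eq hl hxy hx hy, span_pair_eq hl' hxy hx' hy']

theorem IsLine.null_rep {l : Submodule K (Fin 7 → K)} (hl : IsLine l) {x y : ℙ K (Fin 7 → K)}
    (hx : x.submodule ≤ l) (hy : y.submodule ≤ l) : Null x.rep y.rep :=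
  hl.null (submodule_le_iff.mp hx) (submodule_le_iff.mp hy)

/-- The form in which the absence of triangles is used: a singular point collinear with two points
of a line is dependent on them. -/
theorem IsLine.mem_of_null {l : Submodule K (Fin 7 → K)} (hl : IsLine l)
    {x y z : ℙ K (Fin 7 → K)} (hxy : x ≠ y) (hz : IsPoint z) (hx : x.submodule ≤ l)
    (hy : y.submodule ≤ l) (hxz : Null x.rep z.rep) (hyz : Null y.rep z.rep) :
    z.submodule ≤ l := by
  have h := Null.not_linearIndependent z.rep_nonzero hz.form_rep hxz.symm hyz.symm
    (hl.null_rep hx hy)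
  rw [submodule_le_iff, ← span_pair_eq hl.1 hxy hx hy]
  by_contra hmem
  exact h (linearIndependent_finCons.mpr
    ⟨Projectivization.linearIndependent_pair_iff_ne.mpr hxy, hmem⟩)

theorem ofVec_injective : Function.Injective (ofVec : (Fin 7 → K) → Zorn K) := by
  intro u v h
  simp only [ofVec, Zorn.mk.injEq, neg_inj] at h
  ext i
  fin_cases i <;> simp [h]

theorem Null.of_smul {u v : Fin 7 → K} {c d : K} (hc : c ≠ 0) (hd : d ≠ 0)
    (h : Null (c • u) (d • v)) : Null u v := by
  have h₁ : Null (c • u) v := by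
    have := (nullSubmodule (c • u)).smul_mem d⁻¹ h
    rwa [inv_smul_smul₀ hd] at this
  have h₂ := (nullSubmodule v).smul_mem c⁻¹ h₁.symm
  rw [inv_smul_smul₀ hc] at h₂
  exact Null.symm h₂

theorem eq_of_smul_rep_eq {x y : ℙ K (Fin 7 → K)} {c d : K} (hc : c ≠ 0)
    (h : c • x.rep = d • y.rep) : x = y := by
  by_contra hne
  have := (LinearIndependent.pair_iff.mp (Projectivization.linearIndependent_pair_iff_ne.mpr hne))
    c (-d) (by rw [h, neg_smul, add_neg_cancel])
  exact hc this.1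

theorem noSmallPolygons_hexagon :
    NoSmallPolygons fun (x : {x : ℙ K (Fin 7 → K) // IsPoint x})
      (l : {l : Submodule K (Fin 7 → K) // IsLine l}) => x.1.submodule ≤ l.1 where
  line_unique {x y l l'} hxy hx hy hx' hy' :=
    Subtype.ext (line_unique l.2.1 l'.2.1 (Subtype.coe_ne_coe.mpr hxy) hx hy hx' hy')
  triangle {x y z l₁ l₂ l₃} hxy hyz hzx n₁ n₂ n₃ i₁ i₂ i₃ i₄ i₅ i₆ := by
    have := l₁.2.mem_of_null (Subtype.coe_ne_coe.mpr hxy) z.2 i₁ i₂ (l₃.2.null_rep i₆ i₅)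
      (l₂.2.null_rep i₃ i₄)
    exact n₁ (Subtype.ext (line_unique l₁.2.1 l₂.2.1 (Subtype.coe_ne_coe.mpr hyz) i₂ this i₃ i₄))
  quadrangle {x y z w l₁ l₂ l₃ l₄} hxy hyz hzw hwx hyw n₁ n₂ n₃ n₄ i₁ i₂ i₃ i₄ i₅ i₆ i₇ i₈ := by
    have hxz : ¬ Null x.1.rep z.1.rep := fun hxz => by
      have := l₁.2.mem_of_null (Subtype.coe_ne_coe.mpr hxy) z.2 i₁ i₂ hxz (l₂.2.null_rep i₃ i₄)
      exact n₁ (Subtype.ext (line_unique l₁.2.1 l₂.2.1 (Subtype.coe_ne_coe.mpr hyz) i₂ this i₃ i₄))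
    obtain ⟨c, hc⟩ := Null.exists_mul_eq y.1.rep_nonzero y.2.form_rep (l₁.2.null_rep i₁ i₂)
      (l₂.2.null_rep i₄ i₃)
    obtain ⟨d, hd⟩ := Null.exists_mul_eq w.1.rep_nonzero w.2.form_rep (l₄.2.null_rep i₈ i₇)
      (l₃.2.null_rep i₅ i₆)
    have hc0 : c ≠ 0 := by
      rintro rfl
      exact hxz (by rw [Null, hc, zero_smul, ofVec_zero])
    -- The same nonzero product `xz` is a multiple of both `y` and `w`.
    exact hyw (Subtype.ext (eq_of_smul_rep_eq hc0 (ofVec_injective (hc.symm.trans hd))))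
  pentagon {x₁ x₂ x₃ x₄ x₅ l₁ l₂ l₃ l₄ l₅} h₁ h₂ h₃ h₄ h₅ n₁ n₂ n₃ n₄ n₅ i₁ i₂ i₃ i₄ i₅ i₆ i₇ i₈
      i₉ i₁₀ := by
    have h₁₃ : ¬ Null x₁.1.rep x₃.1.rep := fun h => by
      have := l₁.2.mem_of_null (Subtype.coe_ne_coe.mpr h₁) x₃.2 i₁ i₂ h (l₂.2.null_rep i₃ i₄)
      exact n₁ (Subtype.ext (line_unique l₁.2.1 l₂.2.1 (Subtype.coe_ne_coe.mpr h₂) i₂ this i₃ i₄))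
    have h₄₁ : ¬ Null x₄.1.rep x₁.1.rep := fun h => by
      have := l₄.2.mem_of_null (Subtype.coe_ne_coe.mpr h₄) x₁.2 i₇ i₈ h (l₅.2.null_rep i₉ i₁₀)
      exact n₄ (Subtype.ext (line_unique l₄.2.1 l₅.2.1 (Subtype.coe_ne_coe.mpr h₅) i₈ this i₉ i₁₀))
    have h₂₅ : ¬ Null x₂.1.rep x₅.1.rep := fun h => by
      have := l₁.2.mem_of_null (Subtype.coe_ne_coe.mpr h₁) x₅.2 i₁ i₂ (l₅.2.null_rep i₁₀ i₉) h
      exact n₅ (Subtype.ext (line_unique l₅.2.1 l₁.2.1 (Subtype.coe_ne_coe.mpr h₅) i₉ i₁₀ this i₁))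
    obtain ⟨c, hc⟩ := Null.exists_mul_eq x₂.1.rep_nonzero x₂.2.form_rep (l₁.2.null_rep i₁ i₂)
      (l₂.2.null_rep i₄ i₃)
    obtain ⟨d, hd⟩ := Null.exists_mul_eq x₅.1.rep_nonzero x₅.2.form_rep (l₄.2.null_rep i₇ i₈)
      (l₅.2.null_rep i₁₀ i₉)
    have hc0 : c ≠ 0 := by
      rintro rfl
      exact h₁₃ (by rw [Null, hc, zero_smul, ofVec_zero])
    have hd0 : d ≠ 0 := by
      rintro rfl
      exact h₄₁ (by rw [Null, hd, zero_smul, ofVec_zero])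
    refine h₂₅ (Null.of_smul hc0 hd0 ?_)
    -- The Moufang identity with `x = x₁`, `y = x₃`, `z = x₄` turns this into a vanishing product of
    -- multiples of `x₂` and `x₅`.
    have h₃₄ : ofVec x₃.1.rep * ofVec x₄.1.rep = 0 := l₃.2.null_rep i₅ i₆
    rw [Null, ← hc, ← hd, moufang, h₃₄, Zorn.mul_zero, Zorn.zero_mul]

theorem noSmallPolygons_complement (H : Submodule K (Fin 7 → K)) :
    NoSmallPolygons fun (x : RemainingPoint H) (l : RemainingLine H) =>
      x.1.submodule ≤ l.1 :=
  noSmallPolygons_hexagon.comap (f := fun x : RemainingPoint H => ⟨x.1, x.2.1⟩)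
    (g := fun l : RemainingLine H => ⟨l.1, l.2.1⟩)
    (fun _ _ h => Subtype.ext (congrArg (fun z => z.1) h))
    (fun _ _ h => Subtype.ext (congrArg (fun z => z.1) h))

end SplitCayley

/-! ### Counting points and lines over a finite field. -/

theorem card_eq_mul_of_card_fiber {A B : Type*} [Finite A] [Finite B] {f : A → B} {k : ℕ}
    (h : ∀ b, Nat.card {a // f a = b} = k) : Nat.card A = Nat.card B * k := by
  rw [← Nat.card_congr (Equiv.sigmaFiberEquiv f), card_sigma_of_const h]

section Counting

variable {K : Type u} [Field K]

/-- The number of vectors of a cone in terms of the number of its points. -/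
theorem card_cone [Finite K] {V : Type*} [AddCommGroup V] [Module K V] [Finite V] {S : Set V}
    (h0 : (0 : V) ∉ S) (hS : ∀ (c : K) (v : V), c ≠ 0 → v ∈ S → c • v ∈ S) :
    Nat.card S = Nat.card {x : ℙ K V // x.rep ∈ S} * (Nat.card K - 1) := by
  have hne : ∀ v : S, (v : V) ≠ 0 := fun v hv => h0 (hv ▸ v.2)
  have hmem : ∀ v : S, (Projectivization.mk K (v : V) (hne v)).rep ∈ S := by
    intro v
    obtain ⟨a, ha⟩ := Projectivization.exists_smul_eq_mk_rep K (v : V) (hne v)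
    rw [← ha]
    exact hS _ _ a.ne_zero v.2
  refine card_eq_mul_of_card_fiber
    (f := fun v : S => (⟨Projectivization.mk K (v : V) (hne v), hmem v⟩ :
      {x : ℙ K V // x.rep ∈ S})) ?_
  rintro ⟨x, hx⟩
  rw [← Nat.card_units K]
  refine (Nat.card_congr (Equiv.ofBijective
    (fun a : Kˣ => (⟨⟨(a : K) • x.rep, hS _ _ a.ne_zero hx⟩, ?_⟩ : {v : S // _})) ⟨?_, ?_⟩)).symm
  · apply Subtype.ext
    change Projectivization.mk K ((a : K) • x.rep) _ = x
    conv_rhs => rw [← x.mk_rep]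
    rw [Projectivization.mk_eq_mk_iff']
    exact ⟨a, rfl⟩
  · intro a b hab
    have := congrArg (fun z => ((z.1 : S) : V)) hab
    exact Units.ext (smul_left_injective K x.rep_nonzero this)
  · rintro ⟨⟨v, hv⟩, hvx⟩
    have := congrArg Subtype.val hvx
    dsimp only at this
    conv_rhs at this => rw [← x.mk_rep]
    rw [Projectivization.mk_eq_mk_iff] at this
    obtain ⟨a, ha⟩ := this
    exact ⟨a, Subtype.ext (Subtype.ext ha)⟩

theorem card_fiber_of_ne_zero {V : Type*} [AddCommGroup V] [Module K V] [Module.Finite K V]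
    {n : ℕ} (hV : Module.finrank K V = n + 1) {φ : V →ₗ[K] K} (hφ : φ ≠ 0) (c : K) :
    Nat.card {v // φ v = c} = Nat.card K ^ n := by
  have hsurj : Function.Surjective φ := LinearMap.surjective hφ
  obtain ⟨v₀, hv₀⟩ := hsurj c
  have hker : Module.finrank K (LinearMap.ker φ) = n := by
    have := LinearMap.finrank_range_add_finrank_ker φ
    rw [LinearMap.range_eq_top.mpr hsurj, finrank_top, Module.finrank_self] at this
    lia
  rw [← hker, ← Module.natCard_eq_pow_finrank]
  refine Nat.card_congr
    { toFun := fun v => ⟨v.1 - v₀, by simp [v.2, hv₀]⟩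
      invFun := fun v => ⟨v.1 + v₀, by simp [hv₀]⟩
      left_inv := fun v => by simp
      right_inv := fun v => by simp }

open scoped Classical in
-- Each nonzero first vector leaves an affine plane of second vectors; the zero vector contributes
-- only when `c = 0`, and then all of `K ^ 3`.
theorem card_dotProduct_eq [Finite K] (c : K) :
    Nat.card {p : (Fin 3 → K) × (Fin 3 → K) // p.1 ⬝ᵥ p.2 = c} =
      (Nat.card K ^ 3 - 1) * Nat.card K ^ 2 + if c = 0 then Nat.card K ^ 3 else 0 := by
  have := Fintype.ofFinite K
  let e : {p : (Fin 3 → K) × (Fin 3 → K) // p.1 ⬝ᵥ p.2 = c} ≃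
      Σ x : Fin 3 → K, {y : Fin 3 → K // x ⬝ᵥ y = c} :=
    { toFun := fun p => ⟨p.1.1, p.1.2, p.2⟩
      invFun := fun z => ⟨(z.1, z.2.1), z.2.2⟩
      left_inv := fun _ => rfl
      right_inv := fun _ => rfl }
  have h0 : Nat.card {y : Fin 3 → K // (0 : Fin 3 → K) ⬝ᵥ y = c} =
      if c = 0 then Nat.card K ^ 3 else 0 := by
    split_ifs with hc
    · subst hc
      simp
    · have : IsEmpty {y : Fin 3 → K // (0 : Fin 3 → K) ⬝ᵥ y = c} :=
        ⟨fun y => hc (by rw [← y.2, zero_dotProduct])⟩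
      exact Nat.card_of_isEmpty
  have h1 : ∀ x ∈ Finset.univ.erase (0 : Fin 3 → K),
      Nat.card {y : Fin 3 → K // x ⬝ᵥ y = c} = Nat.card K ^ 2 := by
    intro x hx
    refine card_fiber_of_ne_zero (φ := dotProductBilin K K x) (by simp) ?_ c
    intro h
    exact (Finset.mem_erase.mp hx).1 (dotProduct_eq_zero x fun y => by
      simpa using LinearMap.congr_fun h y)
  rw [Nat.card_congr e, Nat.card_sigma, ← Finset.add_sum_erase _ _ (Finset.mem_univ 0), h0,
    Finset.sum_congr rfl h1, Finset.sum_const, Finset.card_erase_of_mem (Finset.mem_univ _),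
    Finset.card_univ, ← Nat.card_eq_fintype_card, Nat.card_fun, add_comm]
  simp

theorem card_sdiff_submodule [Finite K] {V : Type*} [AddCommGroup V] [Module K V] [Module.Finite K V]
    {A B : Submodule K V} (h : B ≤ A) :
    Nat.card {v | v ∈ A ∧ v ∉ B} =
      Nat.card K ^ Module.finrank K A - Nat.card K ^ Module.finrank K B := by
  have : Finite V := Module.finite_of_finite K
  rw [← Module.natCard_eq_pow_finrank, ← Module.natCard_eq_pow_finrank]
  exact Set.ncard_sdiff h

namespace SplitCayley

theorem card_zeros_form [Finite K] : Nat.card {v : Fin 7 → K // form K v = 0} = Nat.card K ^ 6 := by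
  classical
  have := Fintype.ofFinite K
  let e₁ : {v : Fin 7 → K // form K v = 0} ≃
      {z : K × (Fin 3 → K) × (Fin 3 → K) // z.2.1 ⬝ᵥ z.2.2 = z.1 * z.1} :=
    { toFun := fun v => ⟨(v.1 3, ![v.1 0, v.1 1, v.1 2], ![v.1 4, v.1 5, v.1 6]), by
        have := v.2
        rw [form_apply] at this
        simp only [dotProduct, Fin.sum_univ_three, Matrix.cons_val]
        linear_combination this⟩
      invFun := fun z => ⟨![z.1.2.1 0, z.1.2.1 1, z.1.2.1 2, z.1.1, z.1.2.2 0, z.1.2.2 1,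
          z.1.2.2 2], by
        have := z.2
        simp only [dotProduct, Fin.sum_univ_three] at this
        simp only [form_apply, Matrix.cons_val, this, sub_self]⟩
      left_inv := fun v => by
        apply Subtype.ext
        ext i
        fin_cases i <;> rfl
      right_inv := fun z => by
        apply Subtype.ext
        refine Prod.ext rfl (Prod.ext ?_ ?_) <;> ext i <;> fin_cases i <;> rfl }
  let e₂ : {z : K × (Fin 3 → K) × (Fin 3 → K) // z.2.1 ⬝ᵥ z.2.2 = z.1 * z.1} ≃
      Σ c : K, {p : (Fin 3 → K) × (Fin 3 → K) // p.1 ⬝ᵥ p.2 = c * c} :=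
    { toFun := fun z => ⟨z.1.1, z.1.2, z.2⟩
      invFun := fun z => ⟨(z.1, z.2.1), z.2.2⟩
      left_inv := fun _ => rfl
      right_inv := fun _ => rfl }
  -- Sorting by coordinate 3, only the value 0 receives the extra `q ^ 3`, so the total is `q (q ^ 3
  -- - 1) q ^ 2 + q ^ 3 = q ^ 6`.
  rw [Nat.card_congr (e₁.trans e₂), Nat.card_sigma]
  simp only [card_dotProduct_eq, mul_self_eq_zero, Finset.sum_add_distrib, Finset.sum_ite_eq',
    Finset.mem_univ, if_true, Finset.sum_const, Finset.card_univ, ← Nat.card_eq_fintype_card,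
    smul_eq_mul]
  have : 0 < Nat.card K := Nat.card_pos
  have : 1 ≤ Nat.card K ^ 3 := Nat.one_le_pow _ _ this
  zify [this]
  ring

theorem card_zeros_hyperbolicForm [Finite K] : Nat.card {v : Fin 6 → K // hyperbolicForm K v = 0} =
    (Nat.card K ^ 3 - 1) * Nat.card K ^ 2 + Nat.card K ^ 3 := by
  classical
  have h := card_dotProduct_eq (0 : K)
  rw [if_pos rfl] at h
  rw [← h]
  refine Nat.card_congr
    { toFun := fun v => ⟨(![v.1 0, v.1 2, v.1 4], ![v.1 1, v.1 3, v.1 5]), by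
        have := v.2
        simpa [hyperbolicForm, dotProduct, Fin.sum_univ_three] using this⟩
      invFun := fun z => ⟨![z.1.1 0, z.1.2 0, z.1.1 1, z.1.2 1, z.1.1 2, z.1.2 2], by
        have := z.2
        simpa [hyperbolicForm, dotProduct, Fin.sum_univ_three] using this⟩
      left_inv := fun v => by
        apply Subtype.ext
        ext i
        fin_cases i <;> rfl
      right_inv := fun z => by
        apply Subtype.ext
        refine Prod.ext ?_ ?_ <;> ext i <;> fin_cases i <;> rfl }

theorem card_remainingPoint [Finite K] {H : Submodule K (Fin 7 → K)}
    (hH : IsHyperbolicHyperplane H) :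
    Nat.card (RemainingPoint H) = Nat.card K ^ 2 * (Nat.card K ^ 3 - 1) := by
  obtain ⟨-, ⟨e⟩⟩ := hH
  have hK : 1 < Nat.card K := Finite.one_lt_card
  have hin : {v : Fin 7 → K | form K v = 0 ∧ v ∈ H}.ncard =
      (Nat.card K ^ 3 - 1) * Nat.card K ^ 2 + Nat.card K ^ 3 := by
    rw [← card_zeros_hyperbolicForm, ← Nat.card_coe_set_eq]
    refine Nat.card_congr
      { toFun := fun v => ⟨e ⟨v.1, v.2.2⟩, by rw [e.map_app]; exact v.2.1⟩
        invFun := fun w => ⟨e.symm w.1, by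
          have := e.symm.map_app w.1
          rw [w.2] at this
          exact this, (e.symm w.1).2⟩
        left_inv := fun v => by
          apply Subtype.ext
          change ((e.toLinearEquiv.symm (e.toLinearEquiv ⟨v.1, v.2.2⟩) : H) : Fin 7 → K) = v.1
          rw [LinearEquiv.symm_apply_apply]
        right_inv := fun w => Subtype.ext (e.toLinearEquiv.apply_symm_apply w.1) }
  have hall : {v : Fin 7 → K | form K v = 0}.ncard = Nat.card K ^ 6 := card_zeros_form
  have hdiff : Nat.card {v : Fin 7 → K | form K v = 0 ∧ v ∉ H} +
      ((Nat.card K ^ 3 - 1) * Nat.card K ^ 2 + Nat.card K ^ 3) = Nat.card K ^ 6 := by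
    rw [← hin, ← hall, Nat.card_coe_set_eq, add_comm]
    exact Set.ncard_inter_add_ncard_sdiff_eq_ncard {v : Fin 7 → K | form K v = 0} (H : Set _)
  have hcone := card_cone (K := K) (S := {v : Fin 7 → K | form K v = 0 ∧ v ∉ H})
    (fun h => h.2 H.zero_mem) (fun c v hc hv => ⟨by
      rw [QuadraticMap.map_smul, hv.1, smul_zero], fun h => hv.2 ((H.smul_mem_iff hc).mp h)⟩)
  have hpt : Nat.card {x : ℙ K (Fin 7 → K) // x.rep ∈ {v | form K v = 0 ∧ v ∉ H}} =
      Nat.card (RemainingPoint H) := by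
    refine Nat.card_congr (Equiv.subtypeEquivRight fun x => ?_)
    rw [submodule_le_iff]
    refine and_congr ⟨fun h v hv => ?_, IsPoint.form_rep⟩ Iff.rfl
    rw [Projectivization.submodule_eq] at hv
    obtain ⟨c, rfl⟩ := Submodule.mem_span_singleton.mp hv
    rw [QuadraticMap.map_smul, h, smul_zero]
  rw [hpt] at hcone
  rw [hcone] at hdiff
  have h3 : 1 ≤ Nat.card K ^ 3 := Nat.one_le_pow _ _ (by lia)
  have hq : ((Nat.card K : ℤ) - 1) ≠ 0 := by lia
  zify [h3, hK.le] at hdiff ⊢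
  apply mul_right_cancel₀ hq
  linear_combination hdiff

theorem ncard_points_of_line [Finite K] {H l : Submodule K (Fin 7 → K)}
    (hH : Module.finrank K H = 6) (hl : IsLine l) (hlH : ¬ l ≤ H) :
    {x : RemainingPoint H | x.1.submodule ≤ l}.ncard = Nat.card K := by
  have hK : 1 < Nat.card K := Finite.one_lt_card
  have hinf : Module.finrank K (H ⊓ l : Submodule K (Fin 7 → K)) = 1 := by
    have h1 := Submodule.finrank_sup_add_finrank_inf_eq H l
    have h2 : Module.finrank K H < Module.finrank K (H ⊔ l : Submodule K (Fin 7 → K)) :=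
      Submodule.finrank_lt_finrank_of_lt (left_lt_sup.mpr hlH)
    have h3 := Submodule.finrank_le (H ⊔ l)
    rw [Module.finrank_fin_fun] at h3
    rw [hH, hl.1] at h1
    lia
  have h1 := card_sdiff_submodule (A := l) (B := H ⊓ l) inf_le_right
  rw [hinf, hl.1] at h1
  have hcone := card_cone (K := K) (S := {v : Fin 7 → K | v ∈ l ∧ v ∉ H ⊓ l})
    (fun h => h.2 (zero_mem _)) (fun c v hc hv => ⟨l.smul_mem c hv.1,
      fun h => hv.2 (((H ⊓ l).smul_mem_iff hc).mp h)⟩)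
  have hpt : Nat.card {x : ℙ K (Fin 7 → K) // x.rep ∈ {v | v ∈ l ∧ v ∉ H ⊓ l}} =
      {x : RemainingPoint H | x.1.submodule ≤ l}.ncard := by
    rw [← Nat.card_coe_set_eq]
    refine Nat.card_congr
      { toFun := fun x => ⟨⟨x.1, fun v hv => hl.2.1 v (submodule_le_iff.mpr x.2.1 hv),
          fun h => x.2.2 ⟨submodule_le_iff.mp h, x.2.1⟩⟩, submodule_le_iff.mpr x.2.1⟩
        invFun := fun x => ⟨x.1.1, submodule_le_iff.mp x.2,
          fun h => x.1.2.2 (submodule_le_iff.mpr h.1)⟩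
        left_inv := fun _ => rfl
        right_inv := fun _ => rfl }
  rw [hpt, h1, pow_one] at hcone
  have h2 : Nat.card K ≤ Nat.card K ^ 2 := Nat.le_self_pow two_ne_zero _
  have hq : ((Nat.card K : ℤ) - 1) ≠ 0 := by lia
  zify [h2, hK.le] at hcone ⊢
  apply mul_right_cancel₀ hq
  linear_combination -hcone

/-- A plane through `u` is spanned by `u` and some `z`. From `uz = 0` and `u ≠ 0` the vector `z` is
singular, hence `zz = 0`, and bilinearity makes all products on the plane vanish. -/
theorem isLine_iff_of_mem {l : Submodule K (Fin 7 → K)} {u : Fin 7 → K} (hu : u ≠ 0)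
    (hul : u ∈ l) :
    IsLine l ↔ Module.finrank K l = 2 ∧ l ≤ nullSubmodule u := by
  refine ⟨fun hl => ⟨hl.1, fun v hv => hl.null hul hv⟩, fun ⟨h2, hle⟩ => ?_⟩
  have hnull : ∀ v ∈ l, ∀ w ∈ l, Null v w := by
    have hlt : Submodule.span K {u} < l := by
      refine lt_of_le_of_ne ((Submodule.span_singleton_le_iff_mem _ _).mpr hul) fun h => ?_
      rw [← h, finrank_span_singleton hu] at h2
      lia
    obtain ⟨z, hzl, hz⟩ := SetLike.exists_of_lt hlt
    have hspan : l = Submodule.span K {u} ⊔ Submodule.span K {z} := by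
      refine (Submodule.eq_of_le_of_finrank_le (sup_le hlt.le
        ((Submodule.span_singleton_le_iff_mem _ _).mpr hzl)) ?_).symm
      have := Submodule.finrank_lt_finrank_of_lt (left_lt_sup.mpr fun h =>
        hz ((Submodule.span_singleton_le_iff_mem z (Submodule.span K {u})).mp h))
      rw [finrank_span_singleton hu] at this
      lia
    have huz : Null u z := hle hzl
    have hle' : l ≤ nullSubmodule z := by
      rw [hspan]
      refine sup_le ?_ ?_ <;> rw [Submodule.span_singleton_le_iff_mem]
      exacts [huz.symm, null_self (huz.form_eq_zero hu)]
    intro v hv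
    have : l ≤ nullSubmodule v := by
      rw [hspan]
      refine sup_le ?_ ?_ <;> rw [Submodule.span_singleton_le_iff_mem]
      exacts [(hle hv).symm, (hle' hv).symm]
    exact fun w hw => this hw
  exact ⟨h2, fun v hv => Null.form_eq_zero (hle hv) hu,
    fun v hv w hw => ((null_iff v w).mp (hnull v hv w hw)).2⟩

/-- These lines are the planes through `u` in the three-dimensional `nullSubmodule u`, so there are
`(q ^ 3 - q) / (q ^ 2 - q)` of them. -/
theorem ncard_lines_through [Finite K] {u : Fin 7 → K} (hu : u ≠ 0) (hf : form K u = 0) :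
    {l : Submodule K (Fin 7 → K) | IsLine l ∧ u ∈ l}.ncard = Nat.card K + 1 := by
  have hK : 1 < Nat.card K := Finite.one_lt_card
  have hfin : Finite (Submodule K (Fin 7 → K)) :=
    Finite.of_injective (fun l => (l : Set (Fin 7 → K))) SetLike.coe_injective
  have hsp {W : Submodule K (Fin 7 → K)} (hW : u ∈ W) : Submodule.span K {u} ≤ W :=
    (Submodule.span_singleton_le_iff_mem _ _).mpr hW
  have hspan {l : Submodule K (Fin 7 → K)} (h2 : Module.finrank K l = 2) (hul : u ∈ l)
      {v : Fin 7 → K} (hv : v ∈ l) (hvu : v ∉ Submodule.span K {u}) :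
      Submodule.span K {u} ⊔ Submodule.span K {v} = l := by
    refine Submodule.eq_of_le_of_finrank_le (sup_le (hsp hul)
      ((Submodule.span_singleton_le_iff_mem _ _).mpr hv)) ?_
    have := Submodule.finrank_lt_finrank_of_lt (left_lt_sup.mpr fun h =>
      hvu ((Submodule.span_singleton_le_iff_mem v (Submodule.span K {u})).mp h))
    rw [finrank_span_singleton hu] at this
    lia
  have hline : ∀ v : {v | v ∈ nullSubmodule u ∧ v ∉ Submodule.span K {u}},
      IsLine (Submodule.span K {u} ⊔ Submodule.span K {v.1}) ∧
        u ∈ Submodule.span K {u} ⊔ Submodule.span K {v.1} := by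
    intro v
    have hmem : u ∈ Submodule.span K {u} ⊔ Submodule.span K {v.1} :=
      Submodule.mem_sup_left (Submodule.mem_span_singleton_self u)
    refine ⟨(isLine_iff_of_mem hu hmem).mpr ⟨?_, sup_le (hsp (null_self hf))
      ((Submodule.span_singleton_le_iff_mem _ _).mpr v.2.1)⟩, hmem⟩
    have h1 := Submodule.finrank_lt_finrank_of_lt (left_lt_sup.mpr fun h =>
      v.2.2 ((Submodule.span_singleton_le_iff_mem v.1 (Submodule.span K {u})).mp h))
    have h2 := Submodule.finrank_add_le_finrank_add_finrank (Submodule.span K {u})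
      (Submodule.span K {v.1})
    have h3 : v.1 ≠ 0 := fun h => v.2.2 (h ▸ zero_mem _)
    rw [finrank_span_singleton hu] at h1 h2
    rw [finrank_span_singleton h3] at h2
    lia
  have hcard := card_eq_mul_of_card_fiber (k := Nat.card K ^ 2 - Nat.card K)
    (f := fun v : {v | v ∈ nullSubmodule u ∧ v ∉ Submodule.span K {u}} =>
      (⟨_, hline v⟩ : {l : Submodule K (Fin 7 → K) | IsLine l ∧ u ∈ l})) (by
    rintro ⟨l, hl, hul⟩
    have := card_sdiff_submodule (hsp hul)
    rw [hl.1, finrank_span_singleton hu, pow_one] at this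
    rw [← this]
    refine Nat.card_congr
      { toFun := fun v => ⟨v.1.1, by
          have := congrArg Subtype.val v.2
          dsimp only at this
          exact this.le (Submodule.mem_sup_right (Submodule.mem_span_singleton_self _)), v.1.2.2⟩
        invFun := fun v => ⟨⟨v.1, hl.null hul v.2.1, v.2.2⟩,
          Subtype.ext (hspan hl.1 hul v.2.1 v.2.2)⟩
        left_inv := fun _ => rfl
        right_inv := fun _ => rfl })
  rw [card_sdiff_submodule (hsp (null_self hf)), finrank_nullSubmodule hu hf,
    finrank_span_singleton hu, pow_one, Nat.card_coe_set_eq] at hcard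
  have h2 : Nat.card K ≤ Nat.card K ^ 2 := Nat.le_self_pow two_ne_zero _
  have h3 : Nat.card K ≤ Nat.card K ^ 3 := Nat.le_self_pow three_ne_zero _
  have hq : ((Nat.card K : ℤ) ^ 2 - Nat.card K) ≠ 0 := by
    have : (Nat.card K : ℤ) ^ 2 - Nat.card K = Nat.card K * (Nat.card K - 1) := by ring
    rw [this]
    exact mul_ne_zero (by lia) (by lia)
  zify [h2, h3] at hcard ⊢
  apply mul_right_cancel₀ hq
  linear_combination -hcard

theorem ncard_lines_of_point [Finite K] {H : Submodule K (Fin 7 → K)} (x : RemainingPoint H) :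
    {l : RemainingLine H | x.1.submodule ≤ l.1}.ncard = Nat.card K + 1 := by
  rw [← ncard_lines_through x.1.rep_nonzero x.2.1.form_rep,
    ← Set.ncard_image_of_injective _ Subtype.val_injective]
  congr 1
  ext l
  simp only [Set.mem_image, Set.mem_ofPred_eq, Subtype.exists, exists_and_left, exists_prop,
    exists_eq_right_right, submodule_le_iff]
  refine ⟨fun h => ⟨h.2.1, h.1⟩, fun h => ⟨h.2, h.1, fun hle => x.2.2 ?_⟩⟩
  exact submodule_le_iff.mpr (hle h.2)

end SplitCayley

end Counting

/-! ### The complement of a hyperbolic hyperplane. -/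

namespace SplitCayley

variable {K : Type u} [Field K]

theorem exists_isHyperbolicHyperplane :
    ∃ H : Submodule K (Fin 7 → K), IsHyperbolicHyperplane H := by
  -- On `X₃ = 0` the form is already a sum of three hyperbolic planes.
  refine ⟨LinearMap.ker (LinearMap.proj 3 : (Fin 7 → K) →ₗ[K] K), ?_, ⟨?_⟩⟩
  · have h := LinearMap.finrank_range_add_finrank_ker (LinearMap.proj 3 : (Fin 7 → K) →ₗ[K] K)
    rw [LinearMap.range_eq_top.mpr (LinearMap.proj_surjective 3), finrank_top,
      Module.finrank_self, Module.finrank_fin_fun] at h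
    lia
  · exact
    { toFun := fun v => ![v.1 0, v.1 4, v.1 1, v.1 5, v.1 2, v.1 6]
      invFun := fun w => ⟨![w 0, w 2, w 4, 0, w 1, w 3, w 5], by simp⟩
      map_add' := fun v w => by ext i; fin_cases i <;> rfl
      map_smul' := fun c v => by ext i; fin_cases i <;> rfl
      left_inv := fun v => by
        have hv : v.1 3 = 0 := LinearMap.mem_ker.mp v.2
        apply Subtype.ext
        ext i
        fin_cases i <;> first | rfl | exact hv.symm
      right_inv := fun w => by ext i; fin_cases i <;> rfl
      map_app' := fun v => by
        have hv : v.1 3 = 0 := LinearMap.mem_ker.mp v.2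
        simp [hyperbolicForm, form_apply, QuadraticMap.restrict_apply, hv] }

theorem card_remainingLine_mul [Finite K] {H : Submodule K (Fin 7 → K)}
    (hH : Module.finrank K H = 6) :
    Nat.card (RemainingLine H) * Nat.card K = Nat.card (RemainingPoint H) * (Nat.card K + 1) := by
  have hfin : Finite (Submodule K (Fin 7 → K)) :=
    Finite.of_injective (fun l => (l : Set (Fin 7 → K))) SetLike.coe_injective
  let e : (Σ l : RemainingLine H, {x : RemainingPoint H | x.1.submodule ≤ l.1}) ≃
      Σ x : RemainingPoint H, {l : RemainingLine H | x.1.submodule ≤ l.1} :=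
    { toFun := fun z => ⟨z.2.1, z.1, z.2.2⟩
      invFun := fun z => ⟨z.2.1, z.1, z.2.2⟩
      left_inv := fun _ => rfl
      right_inv := fun _ => rfl }
  rw [← card_sigma_of_const (B := fun l : RemainingLine H =>
      {x : RemainingPoint H | x.1.submodule ≤ l.1}), Nat.card_congr e, card_sigma_of_const]
  · intro x
    rw [Nat.card_coe_set_eq, ncard_lines_of_point]
  · intro l
    rw [Nat.card_coe_set_eq, ncard_points_of_line hH l.2.1 l.2.2]

theorem card_remaining [Finite K] {H : Submodule K (Fin 7 → K)}
    (hH : IsHyperbolicHyperplane H) : Nat.card (RemainingPoint H ⊕ RemainingLine H) =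
      (2 * Nat.card K + 1) * (Nat.card K ^ 4 - Nat.card K) := by
  have hfin : Finite (Submodule K (Fin 7 → K)) :=
    Finite.of_injective (fun l => (l : Set (Fin 7 → K))) SetLike.coe_injective
  have hK : 1 < Nat.card K := Finite.one_lt_card
  have h := card_remainingLine_mul hH.1
  rw [Nat.card_sum, card_remainingPoint hH] at *
  have h3 : 1 ≤ Nat.card K ^ 3 := Nat.one_le_pow _ _ (by lia)
  have h4 : Nat.card K ≤ Nat.card K ^ 4 := Nat.le_self_pow four_ne_zero _
  have hq : (Nat.card K : ℤ) ≠ 0 := by lia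
  zify [h3, h4] at h ⊢
  apply mul_right_cancel₀ hq
  linear_combination h

theorem isBBGraph_complementGraph [Finite K] {H : Submodule K (Fin 7 → K)}
    (hH : IsHyperbolicHyperplane H) (hK : 2 < Nat.card K) :
    IsBBGraph (complementGraph H) (Nat.card K) (Nat.card K + 1) 12 := by
  have hfin : Finite (Submodule K (Fin 7 → K)) :=
    Finite.of_injective (fun l => (l : Set (Fin 7 → K))) SetLike.coe_injective
  have hcard := card_remainingPoint hH
  have h3 : 1 < Nat.card K ^ 3 := Nat.one_lt_pow three_ne_zero (by lia)
  have hpos : 0 < Nat.card (RemainingPoint H) := by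
    rw [hcard]
    exact Nat.mul_pos (by positivity) (by lia)
  have hP : Nonempty (RemainingPoint H) := (Nat.card_pos_iff.mp hpos).1
  have x₀ := hP.some
  have hL : Nonempty (RemainingLine H) := by
    have := ncard_lines_of_point x₀
    obtain ⟨l, -⟩ := Set.nonempty_of_ncard_ne_zero (s := {l : RemainingLine H |
      x₀.1.submodule ≤ l.1}) (by lia)
    exact ⟨l⟩
  have hlines : ∀ x : RemainingPoint H,
      {l : RemainingLine H | x.1.submodule ≤ l.1}.ncard = Nat.card K + 1 := ncard_lines_of_point
  have hpoints : ∀ l : RemainingLine H,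
      {x : RemainingPoint H | x.1.submodule ≤ l.1}.ncard = Nat.card K :=
    fun l => ncard_points_of_line hH.1 l.2.1 l.2.2
  obtain ⟨v, w, hw, hle⟩ := (noSmallPolygons_complement H).exists_isCycle hlines hpoints x₀ (by
    rw [hcard]
    -- With `q = s + 3`, the difference of `(q + 1)(q - 1)(q(q - 1))²` and `q²(q³ - 1)` is a
    -- polynomial in `s` that is visibly positive.
    obtain ⟨s, hs⟩ := Nat.exists_eq_add_of_lt hK
    rw [hs] at h3 ⊢
    simp only [Nat.add_sub_cancel]
    zify [h3.le]
    rw [← sub_pos]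
    ring_nf
    positivity)
  exact (noSmallPolygons_complement H).isBBGraph hK.le (Nat.le_succ _) hlines hpoints hw hle

end SplitCayley

/-! ### A replacement graph for `q = 2`. -/

/-- Incidence between the vertices and the edges of the cubic Cayley graph of girth six on
twenty-eight vertices that joins `x` in the first copy of `ZMod 14` to `x`, `x + 1` and `x + 3` in
the second copy. -/
def haarIncidence (p : Bool × ZMod 14) (l : ZMod 14 × Fin 3) : Prop :=
  p.2 = l.1 + if p.1 then ![0, 1, 3] l.2 else 0

theorem haarIncidence_ne {p p' : Bool × ZMod 14} {l : ZMod 14 × Fin 3} (h : haarIncidence p l)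
    (h' : haarIncidence p' l) (hne : p ≠ p') : p.1 ≠ p'.1 := fun heq =>
  hne (Prod.ext heq (by rw [h, h', heq]))

/-- Going around a 4-cycle of the cubic graph would make such an alternating sum of shifts vanish.
-/
theorem haar_differences : ∀ a b c d : Fin 3, a ≠ b → b ≠ c → c ≠ d → d ≠ a →
    (![0, 1, 3] a - ![0, 1, 3] b + ![0, 1, 3] c - ![0, 1, 3] d : ZMod 14) ≠ 0 := by
  decide

theorem haarIncidence_quadrangle {x₁ x₂ x₃ x₄ : ZMod 14} {l₁ l₂ l₃ l₄ : ZMod 14 × Fin 3}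
    (n₁ : l₁ ≠ l₂) (n₂ : l₂ ≠ l₃) (n₃ : l₃ ≠ l₄) (n₄ : l₄ ≠ l₁)
    (i₁ : haarIncidence (false, x₁) l₁) (i₂ : haarIncidence (true, x₂) l₁)
    (i₃ : haarIncidence (true, x₂) l₂) (i₄ : haarIncidence (false, x₃) l₂)
    (i₅ : haarIncidence (false, x₃) l₃) (i₆ : haarIncidence (true, x₄) l₃)
    (i₇ : haarIncidence (true, x₄) l₄) : ¬ haarIncidence (false, x₁) l₄ := by
  intro i₈
  obtain ⟨a₁, j₁⟩ := l₁
  obtain ⟨a₂, j₂⟩ := l₂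
  obtain ⟨a₃, j₃⟩ := l₃
  obtain ⟨a₄, j₄⟩ := l₄
  simp only [haarIncidence, if_true, Bool.false_eq_true, if_false, add_zero] at *
  subst i₁ i₂ i₄ i₆ i₅ i₈
  refine haar_differences j₁ j₂ j₃ j₄ ?_ ?_ ?_ ?_ ?_
  · rintro rfl
    exact n₁ (by rw [add_right_cancel i₃])
  · rintro rfl
    exact n₂ rfl
  · rintro rfl
    exact n₃ (by rw [add_right_cancel i₇])
  · rintro rfl
    exact n₄ rfl
  · linear_combination i₃ + i₇

theorem noSmallPolygons_haarIncidence : NoSmallPolygons haarIncidence where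
  line_unique {p p' l l'} hne h₁ h₂ h₃ h₄ := by
    have := haarIncidence_ne h₁ h₂ hne
    obtain ⟨b, x⟩ := p
    obtain ⟨b', x'⟩ := p'
    obtain ⟨a, j⟩ := l
    obtain ⟨a', j'⟩ := l'
    have hd : ∀ i j : Fin 3, (![0, 1, 3] i : ZMod 14) = ![0, 1, 3] j → i = j := by decide
    cases b <;> cases b' <;> simp [haarIncidence] at * <;> subst h₁ h₂ <;>
      simp_all
    all_goals exact hd _ _ (by assumption)
  triangle {p₁ p₂ p₃ l₁ l₂ l₃} h₁ h₂ h₃ n₁ n₂ n₃ i₁ i₂ i₃ i₄ i₅ i₆ := by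
    have a₁ := haarIncidence_ne i₁ i₂ h₁
    have a₂ := haarIncidence_ne i₃ i₄ h₂
    have a₃ := haarIncidence_ne i₅ i₆ h₃
    revert a₁ a₂ a₃
    -- The two copies of `ZMod 14` alternate along edges, so odd polygons are impossible.
    cases p₁.1 <;> cases p₂.1 <;> cases p₃.1 <;> decide
  quadrangle {p₁ p₂ p₃ p₄ l₁ l₂ l₃ l₄} h₁ h₂ h₃ h₄ h₅ n₁ n₂ n₃ n₄ i₁ i₂ i₃ i₄ i₅ i₆ i₇ i₈ := by
    have a₁ := haarIncidence_ne i₁ i₂ h₁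
    have a₂ := haarIncidence_ne i₃ i₄ h₂
    have a₃ := haarIncidence_ne i₅ i₆ h₃
    obtain ⟨b₁, x₁⟩ := p₁
    obtain ⟨b₂, x₂⟩ := p₂
    obtain ⟨b₃, x₃⟩ := p₃
    obtain ⟨b₄, x₄⟩ := p₄
    cases b₁ <;> cases b₂ <;> cases b₃ <;> cases b₄ <;> simp at a₁ a₂ a₃
    · exact haarIncidence_quadrangle n₁ n₂ n₃ n₄ i₁ i₂ i₃ i₄ i₅ i₆ i₇ i₈
    -- Here the polygon starts in the second copy; shifting it by one vertex gives the other case.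
    · exact haarIncidence_quadrangle n₂ n₃ n₄ n₁ i₃ i₄ i₅ i₆ i₇ i₈ i₁ i₂
  pentagon {p₁ p₂ p₃ p₄ p₅ l₁ l₂ l₃ l₄ l₅} h₁ h₂ h₃ h₄ h₅ n₁ n₂ n₃ n₄ n₅ i₁ i₂ i₃ i₄ i₅ i₆ i₇ i₈
      i₉ i₁₀ := by
    have a₁ := haarIncidence_ne i₁ i₂ h₁
    have a₂ := haarIncidence_ne i₃ i₄ h₂
    have a₃ := haarIncidence_ne i₅ i₆ h₃
    have a₄ := haarIncidence_ne i₇ i₈ h₄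
    have a₅ := haarIncidence_ne i₉ i₁₀ h₅
    revert a₁ a₂ a₃ a₄ a₅
    cases p₁.1 <;> cases p₂.1 <;> cases p₃.1 <;> cases p₄.1 <;> cases p₅.1 <;> decide

theorem exists_isCycle_haarIncidence :
    ∃ (v : (Bool × ZMod 14) ⊕ (ZMod 14 × Fin 3)) (w : (leviGraph haarIncidence).Walk v v),
      w.IsCycle ∧ w.length = 12 := by
  have step₁ {p l} (h : haarIncidence p l) :
      (leviGraph haarIncidence).Adj (Sum.inl p) (Sum.inr l) := h
  have step₂ {p l} (h : haarIncidence p l) :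
      (leviGraph haarIncidence).Adj (Sum.inr l) (Sum.inl p) := h
  refine ⟨Sum.inl (false, 0),
    .cons (step₁ (l := (0, 0)) (by unfold haarIncidence; decide)) <|
    .cons (step₂ (p := (true, 0)) (by unfold haarIncidence; decide)) <|
    .cons (step₁ (l := (13, 1)) (by unfold haarIncidence; decide)) <|
    .cons (step₂ (p := (false, 13)) (by unfold haarIncidence; decide)) <|
    .cons (step₁ (l := (13, 2)) (by unfold haarIncidence; decide)) <|
    .cons (step₂ (p := (true, 2)) (by unfold haarIncidence; decide)) <|
    .cons (step₁ (l := (2, 0)) (by unfold haarIncidence; decide)) <|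
    .cons (step₂ (p := (false, 2)) (by unfold haarIncidence; decide)) <|
    .cons (step₁ (l := (2, 1)) (by unfold haarIncidence; decide)) <|
    .cons (step₂ (p := (true, 3)) (by unfold haarIncidence; decide)) <|
    .cons (step₁ (l := (0, 2)) (by unfold haarIncidence; decide)) <|
    .cons (step₂ (p := (false, 0)) (by unfold haarIncidence; decide)) .nil, ?_, rfl⟩
  rw [SimpleGraph.Walk.isCycle_def]
  refine ⟨⟨?_⟩, by simp, ?_⟩
  · simp only [SimpleGraph.Walk.edges_cons, SimpleGraph.Walk.edges_nil]
    decide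
  · simp only [SimpleGraph.Walk.support_cons, SimpleGraph.Walk.support_nil, List.tail_cons]
    decide

theorem isBBGraph_haarIncidence : IsBBGraph (leviGraph haarIncidence) 2 3 12 := by
  obtain ⟨v, w, hw, h12⟩ := exists_isCycle_haarIncidence
  refine noSmallPolygons_haarIncidence.isBBGraph le_rfl (by norm_num) ?_ ?_ hw h12.le
  · intro p
    have : {l | haarIncidence p l} =
        Set.range fun j : Fin 3 => (p.2 - if p.1 then ![0, 1, 3] j else 0, j) := by
      ext ⟨a, j⟩
      simp [haarIncidence, sub_eq_iff_eq_add]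
    rw [this, ← Set.image_univ, Set.ncard_image_of_injective _ fun i j h => (Prod.ext_iff.mp h).2]
    simp
  · intro l
    have : {p | haarIncidence p l} =
        Set.range fun b : Bool => (b, l.1 + if b then ![0, 1, 3] l.2 else 0) := by
      ext ⟨b, x⟩
      simp only [haarIncidence, Set.mem_ofPred_eq, Set.mem_range, Prod.mk.injEq, exists_eq_left]
      exact eq_comm
    rw [this, ← Set.image_univ, Set.ncard_image_of_injective _ fun i j h => (Prod.ext_iff.mp h).1]
    simp

theorem IsBBGraph.exists_fin {V : Type} {G : SimpleGraph V} {m n g N : ℕ} (h : IsBBGraph G m n g)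
    (hN : Nat.card V = N) : ∃ G' : SimpleGraph (Fin N), IsBBGraph G' m n g := by
  have := h.finite
  let e := Finite.equivFinOfCardEq hN
  exact ⟨_, h.of_iso (SimpleGraph.Iso.map e G)⟩

theorem mainTheorem6 (q : ℕ) (hq : IsPrimePow q) :
    (∃ G : SimpleGraph (Fin ((2 * q + 1) * (q ^ 4 - q))), IsBBGraph G q (q + 1) 12) ∧
    ∀ (K : Type u) [Field K], Nat.card K = q →
      (∃ H : Submodule K (Fin 7 → K), SplitCayley.IsHyperbolicHyperplane H) ∧
      ∀ H : Submodule K (Fin 7 → K), SplitCayley.IsHyperbolicHyperplane H →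
        Nat.card (SplitCayley.RemainingPoint H ⊕ SplitCayley.RemainingLine H)
            = (2 * q + 1) * (q ^ 4 - q) ∧
        (2 < q → IsBBGraph (SplitCayley.complementGraph H) q (q + 1) 12) := by
  constructor
  · rcases hq.two_le.eq_or_lt with rfl | h2
    -- The 28 vertices and 42 edges of the cubic graph give `70 = (2 * 2 + 1) * (2 ^ 4 - 2)`.
    · exact isBBGraph_haarIncidence.exists_fin (by simp)
    · obtain ⟨p, n, hp, hn, rfl⟩ := hq
      have : Fact p.Prime := ⟨hp.nat_prime⟩
      have hcard := GaloisField.card p n hn.ne'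
      have : Finite (GaloisField p n) := Nat.finite_of_card_ne_zero (by lia)
      obtain ⟨H, hH⟩ := SplitCayley.exists_isHyperbolicHyperplane (K := GaloisField p n)
      rw [← hcard] at h2 ⊢
      exact (SplitCayley.isBBGraph_complementGraph hH h2).exists_fin
        (SplitCayley.card_remaining hH)
  · rintro K _ rfl
    have : Finite K := Nat.finite_of_card_ne_zero hq.ne_zero
    exact ⟨SplitCayley.exists_isHyperbolicHyperplane, fun H hH =>
      ⟨SplitCayley.card_remaining hH, SplitCayley.isBBGraph_complementGraph hH⟩⟩
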